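/- Let $n\ge 3$, let $\lambda$ be a partition of $n$ with $\lambda\ne(n)$ and $\lambda\ne(1^n)$, and let $p$ be a prime. Let $\chi_\lambda$ be the character of the complex Specht module $V_\lambda$ of the symmetric group $S_n$, that is, the submodule spanned by the polytabloids in the permutation module on the tabloids of shape $\lambda$. A character $\chi$ of a finite group $G$ is called quasi $p$-Steinberg if the prime $p$ divides $|G|$, $\chi$ is irreducible, and $\chi(g)\neq 0$ for every $g\in G$ whose order is not divisible by $p$. Then $\chi_\lambda$ is a quasi $p$-Steinberg character of $S_n$ if and only if $(n,\lambda,p)$ is one of the following thirteen triples: - $n=3$: $((2,1),2)$; - $n=4$: $((2,2),2)$, $((3,1),3)$, $((2,1,1),3)$; - $n=5$: $((4,1),2)$, $((2,1,1,1),2)$, $((3,2),5)$, $((2,2,1),5)$; - $n=6$: $((3,2,1),2)$, $((4,2),3)$, $((2,2,1,1),3)$; - $n=8$: $((5,2,1),2)$, $((3,2,1,1,1),2)$, where for each $n$ the pairs listed are the pairs $(\lambda,p)$. In particular, if $\chi_\lambda$ is quasi $p$-Steinberg for such a $\lambda$, then $n\le 8$. -/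

import Mathlib

open Equiv (Perm)

noncomputable section

/-- The Young diagram of a partition of `n` (English convention): the cells are the pairs `(i, j)`
with `j < lam_i`, where `lam_0 ≥ lam_1 ≥ ...` are the parts of `lam` in decreasing order. -/
def Nat.Partition.diagram {n : ℕ} (lam : n.Partition) : YoungDiagram :=
  YoungDiagram.ofRowLens (lam.parts.sort (· ≥ ·)) (Multiset.pairwise_sort _ _).sortedGE

namespace Specht

/-- A Young tableau of shape `μ`: a bijective filling of the cells of `μ` by the elements of
`Fin n` (there are none unless `μ` has exactly `n` cells). -/
abbrev Tableau (n : ℕ) (μ : YoungDiagram) : Type := {c : ℕ × ℕ // c ∈ μ.cells} ≃ Fin n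

namespace Tableau

variable {n : ℕ} {μ : YoungDiagram}

/-- The row of the tableau `t` that contains the entry `i`. -/
def row (t : Tableau n μ) (i : Fin n) : ℕ := (t.symm i).1.1

/-- The column of the tableau `t` that contains the entry `i`. -/
def col (t : Tableau n μ) (i : Fin n) : ℕ := (t.symm i).1.2

/-- The symmetric group acts on tableaux by permuting the entries. -/
def permute (σ : Perm (Fin n)) (t : Tableau n μ) : Tableau n μ := t.trans σ

theorem row_permute (σ : Perm (Fin n)) (t : Tableau n μ) (i : Fin n) :
    row (permute σ t) i = row t (σ⁻¹ i) := rfl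

theorem col_permute (σ : Perm (Fin n)) (t : Tableau n μ) (i : Fin n) :
    col (permute σ t) i = col t (σ⁻¹ i) := rfl

theorem card_row (t : Tableau n μ) (k : ℕ) :
    (Finset.univ.filter fun i => row t i = k).card = μ.rowLen k := by
  rw [YoungDiagram.rowLen_eq_card]
  refine Finset.card_bij (fun i _ => (t.symm i).1) ?_ ?_ ?_
  · intro i hi
    rw [YoungDiagram.mem_row_iff]
    exact ⟨(t.symm i).2, (Finset.mem_filter.1 hi).2⟩
  · intro i _ j _ h
    exact t.symm.injective (Subtype.ext h)
  · intro c hc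
    rw [YoungDiagram.mem_row_iff] at hc
    refine ⟨t ⟨c, hc.1⟩, ?_, by simp⟩
    refine Finset.mem_filter.2 ⟨Finset.mem_univ _, ?_⟩
    simpa [row] using hc.2

/-- The column stabilizer of `t`: the permutations that preserve each column of `t`. -/
def colStabilizer (t : Tableau n μ) : Finset (Perm (Fin n)) :=
  Finset.univ.filter fun π => ∀ i, col t (π i) = col t i

end Tableau

/-- A tabloid of shape `μ`, that is, a tableau up to reordering the entries within each row.
It is recorded by the map that sends an entry to the index of its row; the `k`-th row has
`μ.rowLen k` entries. -/
@[ext]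
structure Tabloid (n : ℕ) (μ : YoungDiagram) : Type where
  row : Fin n → ℕ
  card_row : ∀ k, (Finset.univ.filter fun i => row i = k).card = μ.rowLen k

variable {n : ℕ} {μ : YoungDiagram}

/-- The symmetric group acts on tabloids by permuting the entries. -/
instance : MulAction (Perm (Fin n)) (Tabloid n μ) where
  smul σ T :=
    { row := fun i => T.row (σ⁻¹ i)
      card_row := fun k => by
        rw [← T.card_row k]
        refine Finset.card_bij (fun i _ => σ⁻¹ i) ?_ ?_ ?_
        · intro i hi
          simpa using hi
        · intro i _ j _ h
          exact (σ⁻¹).injective h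
        · intro i hi
          exact ⟨σ i, by simpa using hi, by simp⟩ }
  one_smul _ := rfl
  mul_smul σ τ T := by
    refine Tabloid.ext (funext fun i => ?_)
    change T.row ((σ * τ)⁻¹ i) = T.row (τ⁻¹ (σ⁻¹ i))
    rw [mul_inv_rev, Equiv.Perm.mul_apply]

theorem Tabloid.smul_row (σ : Perm (Fin n)) (T : Tabloid n μ) (i : Fin n) :
    (σ • T).row i = T.row (σ⁻¹ i) := rfl

/-- The tabloid of a tableau. -/
def Tableau.tabloid (t : Tableau n μ) : Tabloid n μ := ⟨Tableau.row t, Tableau.card_row t⟩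

theorem Tableau.tabloid_permute (σ : Perm (Fin n)) (t : Tableau n μ) :
    Tableau.tabloid (Tableau.permute σ t) = σ • Tableau.tabloid t := rfl

/-- The complex permutation representation `M^μ` of `S_n` on the tabloids of shape `μ`. Its space is
the free vector space on the tabloids. -/
abbrev permRep (n : ℕ) (μ : YoungDiagram) :
    Representation ℂ (Perm (Fin n)) (MonoidAlgebra ℂ (Tabloid n μ)) :=
  Representation.ofMulAction ℂ (Perm (Fin n)) (Tabloid n μ)

/-- The polytabloid of `t`: the sum of `sgn(π) π{t}` over `π` in the column stabilizer of `t`,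
where `{t}` is the tabloid of `t`. -/
def polytabloid (t : Tableau n μ) : MonoidAlgebra ℂ (Tabloid n μ) :=
  ∑ π ∈ Tableau.colStabilizer t,
    MonoidAlgebra.single (π • Tableau.tabloid t) ((Equiv.Perm.sign π : ℤ) : ℂ)

theorem permRep_polytabloid (σ : Perm (Fin n)) (t : Tableau n μ) :
    permRep n μ σ (polytabloid t) = polytabloid (Tableau.permute σ t) := by
  unfold polytabloid
  rw [map_sum]
  refine Finset.sum_bij (fun π _ => σ * π * σ⁻¹) ?_ ?_ ?_ ?_
  · intro π hπ
    simp only [Tableau.colStabilizer, Finset.mem_filter, Finset.mem_univ, true_and] at hπ ⊢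
    intro i
    simp [Tableau.col_permute, hπ]
  · intro π _ π' _ h
    simpa using h
  · intro π hπ
    refine ⟨σ⁻¹ * π * σ, ?_, by group⟩
    simp only [Tableau.colStabilizer, Finset.mem_filter, Finset.mem_univ, true_and] at hπ ⊢
    intro i
    simpa [Tableau.col_permute] using hπ (σ i)
  · intro π _
    rw [Representation.ofMulAction_single, Tableau.tabloid_permute, smul_smul, smul_smul]
    congr 1
    · simp
    · rcases Int.units_eq_one_or (Equiv.Perm.sign σ) with h | h <;> simp [h]

/-- The Specht module `V_μ`: the subrepresentation of `M^μ` spanned by the polytabloids. -/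
def spechtModule (n : ℕ) (μ : YoungDiagram) : Subrepresentation (permRep n μ) where
  toSubmodule := Submodule.span ℂ (Set.range (polytabloid (n := n) (μ := μ)))
  apply_mem_toSubmodule σ v hv := by
    induction hv using Submodule.span_induction with
    | mem x hx =>
      obtain ⟨t, rfl⟩ := hx
      rw [permRep_polytabloid]
      exact Submodule.subset_span ⟨_, rfl⟩
    | zero => simp
    | add x y _ _ hx hy => rw [map_add]; exact Submodule.add_mem _ hx hy
    | smul c x _ hx => rw [map_smul]; exact Submodule.smul_mem _ c hx

end Specht

/-- The representation of `S_n` on the Specht module of a partition of `n`. Its character is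
the irreducible character `χ_lam`. -/
def spechtRep {n : ℕ} (lam : n.Partition) :
    Representation ℂ (Perm (Fin n)) (Specht.spechtModule n lam.diagram).toSubmodule :=
  (Specht.spechtModule n lam.diagram).toRepresentation

/-- The character of the representation `ρ` of the finite group `G` is a quasi `p`-Steinberg
character, where `p` is a prime: `p` divides the order of `G`, the character is irreducible, and it
is nonzero on every `p`-regular element of `G`. -/
structure IsQuasiSteinberg {G V : Type*} [Group G] [AddCommGroup V] [Module ℂ V]
    (p : ℕ) (ρ : Representation ℂ G V) : Prop where
  dvd_card : p ∣ Nat.card G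
  irreducible : ρ.IsIrreducible
  character_ne_zero : ∀ g : G, ¬ p ∣ orderOf g → ρ.character g ≠ 0

end

/-! ### Tableaux, column stabilizers and the signed column sum. -/

noncomputable section

namespace Specht

open Finset

variable {n : ℕ} {μ : YoungDiagram}

/-! Necessity comes from testing the character on a few `p`-regular classes, sufficiency from
evaluating it on all of them. Both need the Murnaghan–Nakayama recursion, while the Specht module is
given by polytabloids. The bridge is Frobenius's formula `character_eq_coeff`: χ(g) is the
coefficient ψ(g) of x^β in the alternant times the product of the power sums p_c over the cycle
lengths c of g, where β_i = λ_i + m - 1 - i are the beta numbers.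

The bridge compares norms. Expanding the alternant writes ψ as a signed sum, over permutations w, of
permutation characters on labellings whose counts dominate λ. The signed column sum of a tableau
annihilates the summands with w ≠ 1, and the summand w = 1 is the tabloid module, which contains V_λ
exactly once; hence ⟨ψ, χ⟩ = 1. The cycle index of S_n and Cauchy's determinant give ⟨ψ, ψ⟩ = 1
(`sum_coeff_frobeniusPoly_sq`), and irreducibility gives ⟨χ, χ⟩ = 1. Both functions are real, so ⟨χ
- ψ, χ - ψ⟩ = 0 forces χ = ψ.

Multiplying by p_k lowers one beta number by k, and an alternating polynomial has no terms with
repeated exponents. So χ vanishes at g if g has a k-cycle and λ has no hook of length k. If p does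
not divide n, the n-cycle shows that λ is a hook; if p divides n, an (n-1)-cycle shows that λ =
(n-m, 2, 1^(m-2)). These shapes have few large hook lengths: cycles of length just below n force p
to divide small numbers, and pairs of cycles then bound n (`classify_hook`, `classify_almost_hook`).
The thirteen surviving triples are verified by computing every `p`-regular value. -/

theorem Tableau.ext_row_col (t : Tableau n μ) {i j : Fin n} (hr : Tableau.row t i = Tableau.row t j)
    (hc : Tableau.col t i = Tableau.col t j) : i = j :=
  t.symm.injective (Subtype.ext (Prod.ext hr hc))

theorem Tableau.row_lt_colLen (t : Tableau n μ) (i : Fin n) :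
    Tableau.row t i < μ.colLen (Tableau.col t i) :=
  YoungDiagram.mem_iff_lt_colLen.1 (t.symm i).2

theorem Tableau.card_col_row_lt (t : Tableau n μ) (c k : ℕ) :
    #{i | Tableau.col t i = c ∧ Tableau.row t i < k} = min k (μ.colLen c) := by
  rw [← card_range (min k (μ.colLen c))]
  refine card_bij (fun i _ => Tableau.row t i) ?_ ?_ ?_
  · intro i hi
    simp only [mem_filter, mem_univ, true_and] at hi
    have := t.row_lt_colLen i
    rw [hi.1] at this
    simp [hi.2, this]
  · intro i hi j hj h
    simp only [mem_filter, mem_univ, true_and] at hi hj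
    exact t.ext_row_col h (hi.1.trans hj.1.symm)
  · intro r hr
    simp only [mem_range, lt_min_iff] at hr
    refine ⟨t ⟨(r, c), YoungDiagram.mem_iff_lt_colLen.2 hr.2⟩, ?_, ?_⟩
    · refine mem_filter.2 ⟨mem_univ _, ?_⟩
      simp [Tableau.row, Tableau.col, hr.1]
    · simp [Tableau.row]

/-- A labelling that is injective on the columns of `t` and whose label counts dominate those of
the rows of `t` is obtained from the row labelling by a permutation in the column stabilizer. -/
theorem Tableau.exists_colStabilizer (t : Tableau n μ) (f : Fin n → ℕ)
    (hdom : ∀ k, #{i | Tableau.row t i < k} ≤ #{i | f i < k})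
    (hinj : ∀ i j, Tableau.col t i = Tableau.col t j → f i = f j → i = j) :
    ∃ π ∈ Tableau.colStabilizer t, ∀ i, f (π i) = Tableau.row t i := by
  -- In each column the labels below k are at most as many as the entries in rows below k. Summed
  -- over columns, `hdom` gives the reverse inequality, so equality holds in every column.
  have key : ∀ c k, #{i | Tableau.col t i = c ∧ f i < k} ≤ min k (μ.colLen c) := by
    intro c k
    refine le_min ?_ ?_
    · rw [← card_range k]
      refine card_le_card_of_injOn f ?_ ?_
      · intro i hi
        simp only [coe_filter, mem_univ, true_and, Set.mem_ofPred_eq] at hi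
        simpa using hi.2
      · intro i hi j hj h
        simp only [coe_filter, mem_univ, true_and, Set.mem_ofPred_eq] at hi hj
        exact hinj i j (hi.1.trans hj.1.symm) h
    · have h := t.card_col_row_lt c (μ.colLen c)
      rw [min_self] at h
      rw [← h]
      refine card_le_card fun i hi => ?_
      simp only [mem_filter, mem_univ, true_and] at hi ⊢
      refine ⟨hi.1, ?_⟩
      have := t.row_lt_colLen i
      rwa [hi.1] at this
  have hsum : ∀ (h : Fin n → ℕ) (k : ℕ), #{i | h i < k} =
      ∑ c ∈ univ.image (Tableau.col t), #{i | Tableau.col t i = c ∧ h i < k} := by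
    intro h k
    rw [card_eq_sum_card_fiberwise (f := Tableau.col t) (t := univ.image (Tableau.col t))]
    · refine sum_congr rfl fun c _ => ?_
      rw [filter_filter]
      simp only [and_comm]
    · intro i _
      simp
  have heq : ∀ c ∈ univ.image (Tableau.col t), ∀ k,
      #{i | Tableau.col t i = c ∧ f i < k} = min k (μ.colLen c) := by
    intro c hc k
    refine (sum_eq_sum_iff_of_le fun c _ => key c k).1 (le_antisymm
      (sum_le_sum fun c _ => key c k) ?_) c hc
    rw [← hsum f k]
    refine le_trans (le_of_eq ?_) (hdom k)
    rw [hsum (Tableau.row t) k]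
    exact sum_congr rfl fun c _ => (t.card_col_row_lt c k).symm
  have hlt : ∀ i, f i < μ.colLen (Tableau.col t i) := by
    intro i
    have h1 := heq (Tableau.col t i) (by simp) (μ.colLen (Tableau.col t i))
    have h2 := t.card_col_row_lt (Tableau.col t i) (μ.colLen (Tableau.col t i))
    have hsub : univ.filter (fun j => Tableau.col t j = Tableau.col t i ∧
          f j < μ.colLen (Tableau.col t i)) =
        univ.filter (fun j => Tableau.col t j = Tableau.col t i ∧
          Tableau.row t j < μ.colLen (Tableau.col t i)) := by
      refine eq_of_subset_of_card_le (fun j hj => ?_) (by rw [h1, h2])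
      simp only [mem_filter, mem_univ, true_and] at hj ⊢
      refine ⟨hj.1, ?_⟩
      have := t.row_lt_colLen j
      rwa [hj.1] at this
    have : i ∈ univ.filter (fun j => Tableau.col t j = Tableau.col t i ∧
        Tableau.row t j < μ.colLen (Tableau.col t i)) := by
      simpa using t.row_lt_colLen i
    rw [← hsub] at this
    simpa using this
  -- By `hlt` the cell in row f i of the column of i exists; g moves i to the entry there, and its
  -- inverse is the required permutation.
  let g : Fin n → Fin n := fun i =>
    t ⟨(f i, Tableau.col t i), YoungDiagram.mem_iff_lt_colLen.2 (hlt i)⟩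
  have hrow : ∀ i, Tableau.row t (g i) = f i := fun i => by simp [g, Tableau.row]
  have hcol : ∀ i, Tableau.col t (g i) = Tableau.col t i := fun i => by
    simp [g, Tableau.col]
  have hg : Function.Injective g := by
    intro i j h
    refine hinj i j ?_ ?_
    · rw [← hcol i, h, hcol j]
    · rw [← hrow i, h, hrow j]
  let σ : Perm (Fin n) := Equiv.ofBijective g (Finite.injective_iff_bijective.1 hg)
  have hσ : ∀ i, g (σ.symm i) = i := fun i => σ.apply_symm_apply i
  refine ⟨σ.symm, ?_, fun i => ?_⟩
  · simp only [Tableau.colStabilizer, mem_filter, mem_univ, true_and]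
    intro i
    rw [← hcol, hσ]
  · rw [← hrow, hσ]

theorem Tableau.mem_colStabilizer {t : Tableau n μ} {π : Perm (Fin n)} :
    π ∈ Tableau.colStabilizer t ↔ ∀ i, Tableau.col t (π i) = Tableau.col t i := by
  simp [Tableau.colStabilizer]

theorem Tableau.mul_mem_colStabilizer {t : Tableau n μ} {π τ : Perm (Fin n)}
    (hπ : π ∈ Tableau.colStabilizer t) (hτ : τ ∈ Tableau.colStabilizer t) :
    π * τ ∈ Tableau.colStabilizer t := by
  rw [Tableau.mem_colStabilizer] at *
  intro i
  rw [Equiv.Perm.mul_apply, hπ, hτ]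

theorem Tableau.inv_mem_colStabilizer {t : Tableau n μ} {π : Perm (Fin n)}
    (hπ : π ∈ Tableau.colStabilizer t) : π⁻¹ ∈ Tableau.colStabilizer t := by
  rw [Tableau.mem_colStabilizer] at *
  intro i
  rw [← hπ (π⁻¹ i)]
  simp

theorem Tableau.one_mem_colStabilizer (t : Tableau n μ) : 1 ∈ Tableau.colStabilizer t := by
  simp [Tableau.mem_colStabilizer]

theorem Tableau.card_colStabilizer_ne_zero (t : Tableau n μ) :
    ((Tableau.colStabilizer t).card : ℂ) ≠ 0 := by
  rw [Nat.cast_ne_zero]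
  exact card_ne_zero_of_mem t.one_mem_colStabilizer

theorem sign_mul_self_complex (π : Perm (Fin n)) :
    ((Equiv.Perm.sign π : ℤ) : ℂ) * ((Equiv.Perm.sign π : ℤ) : ℂ) = 1 := by
  rcases Int.units_eq_one_or (Equiv.Perm.sign π) with h | h <;> simp [h]

section antisymmetrizer

variable {V W : Type*} [AddCommGroup V] [Module ℂ V] [AddCommGroup W] [Module ℂ W]

/-- The signed column sum of `t`, acting on a representation of the symmetric group. -/
def antisymmetrizer (ρ : Representation ℂ (Perm (Fin n)) V) (t : Tableau n μ) : V →ₗ[ℂ] V :=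
  ∑ π ∈ Tableau.colStabilizer t, ((Equiv.Perm.sign π : ℤ) : ℂ) • ρ π

theorem antisymmetrizer_apply (ρ : Representation ℂ (Perm (Fin n)) V) (t : Tableau n μ) (v : V) :
    antisymmetrizer ρ t v =
      ∑ π ∈ Tableau.colStabilizer t, ((Equiv.Perm.sign π : ℤ) : ℂ) • ρ π v := by
  simp [antisymmetrizer]

theorem antisymmetrizer_map {ρ : Representation ℂ (Perm (Fin n)) V}
    {σ : Representation ℂ (Perm (Fin n)) W} (θ : ρ.IntertwiningMap σ) (t : Tableau n μ) (v : V) :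
    antisymmetrizer σ t (θ v) = θ (antisymmetrizer ρ t v) := by
  simp [antisymmetrizer_apply, θ.isIntertwining]

theorem antisymmetrizer_smul (ρ : Representation ℂ (Perm (Fin n)) V) {t : Tableau n μ}
    {τ : Perm (Fin n)} (hτ : τ ∈ Tableau.colStabilizer t) (v : V) :
    antisymmetrizer ρ t (ρ τ v) = ((Equiv.Perm.sign τ : ℤ) : ℂ) • antisymmetrizer ρ t v := by
  rw [antisymmetrizer_apply, antisymmetrizer_apply, smul_sum]
  refine sum_bij (fun π _ => π * τ) (fun π hπ => Tableau.mul_mem_colStabilizer hπ hτ)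
    (fun π _ π' _ h => mul_right_cancel h) (fun π hπ => ⟨π * τ⁻¹,
      Tableau.mul_mem_colStabilizer hπ (Tableau.inv_mem_colStabilizer hτ), by simp⟩) ?_
  intro π _
  rw [smul_smul, Equiv.Perm.sign_mul, Units.val_mul, Int.cast_mul, mul_left_comm,
    sign_mul_self_complex, mul_one, map_mul]
  rfl

theorem antisymmetrizer_antisymmetrizer (ρ : Representation ℂ (Perm (Fin n)) V) (t : Tableau n μ)
    (v : V) : antisymmetrizer ρ t (antisymmetrizer ρ t v) =
      ((Tableau.colStabilizer t).card : ℂ) • antisymmetrizer ρ t v := by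
  conv_lhs => rw [antisymmetrizer_apply ρ t v]
  rw [map_sum, Nat.cast_smul_eq_nsmul]
  refine sum_eq_card_nsmul fun π hπ => ?_
  rw [map_smul, antisymmetrizer_smul ρ hπ, smul_smul, sign_mul_self_complex, one_smul]

/-- The transposition is an odd element of the column stabilizer, so the antisymmetrized vector
equals its own negative. -/
theorem antisymmetrizer_eq_zero (ρ : Representation ℂ (Perm (Fin n)) V) {t : Tableau n μ}
    {i j : Fin n} (hij : i ≠ j) (hc : Tableau.col t i = Tableau.col t j) {v : V}
    (hv : ρ (Equiv.swap i j) v = v) : antisymmetrizer ρ t v = 0 := by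
  have hm : Equiv.swap i j ∈ Tableau.colStabilizer t := by
    rw [Tableau.mem_colStabilizer]
    intro k
    rw [Equiv.swap_apply_def]
    split_ifs with h1 h2
    · rw [h1, hc]
    · rw [h2, hc]
    · rfl
  have h := antisymmetrizer_smul ρ hm v
  rw [hv, Equiv.Perm.sign_swap hij] at h
  simp only [Units.val_neg, Units.val_one, Int.cast_neg, Int.cast_one, neg_smul, one_smul] at h
  have h2 : (2 : ℂ) • antisymmetrizer ρ t v = 0 := by
    rw [two_smul]
    nth_rewrite 1 [h]
    exact neg_add_cancel _
  exact (smul_eq_zero.1 h2).resolve_left two_ne_zero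

end antisymmetrizer

theorem polytabloid_eq_antisymmetrizer (t : Tableau n μ) :
    polytabloid t = antisymmetrizer (permRep n μ) t
      (MonoidAlgebra.single (Tableau.tabloid t) 1) := by
  simp [polytabloid, antisymmetrizer_apply]

theorem antisymmetrizer_polytabloid (t : Tableau n μ) :
    antisymmetrizer (permRep n μ) t (polytabloid t) =
      ((Tableau.colStabilizer t).card : ℂ) • polytabloid t := by
  rw [polytabloid_eq_antisymmetrizer, antisymmetrizer_antisymmetrizer]

section labelled

variable {X : Type*} [MulAction (Perm (Fin n)) X]

/-- On a permutation module whose basis consists of labellings with dominating counts, the signed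
column sum kills every basis vector that is not column equivalent to the rows of `t`. -/
theorem antisymmetrizer_single (r : X → Fin n → ℕ) (hr : Function.Injective r)
    (hsmul : ∀ (g : Perm (Fin n)) x i, r (g • x) i = r x (g⁻¹ i)) (t : Tableau n μ)
    (hdom : ∀ x k, #{i | Tableau.row t i < k} ≤ #{i | r x i < k}) (x : X) :
    antisymmetrizer (Representation.ofMulAction ℂ (Perm (Fin n)) X) t
        (MonoidAlgebra.single x 1) = 0 ∨
      ∃ π ∈ Tableau.colStabilizer t, r (π⁻¹ • x) = Tableau.row t := by
  by_cases h : ∀ i j, Tableau.col t i = Tableau.col t j → r x i = r x j → i = j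
  · right
    obtain ⟨π, hπ, h⟩ := t.exists_colStabilizer (r x) (hdom x) h
    refine ⟨π, hπ, funext fun i => ?_⟩
    rw [hsmul, inv_inv, h]
  · left
    push Not at h
    obtain ⟨i, j, hc, hij, hne⟩ := h
    refine antisymmetrizer_eq_zero _ hne hc ?_
    rw [Representation.ofMulAction_single]
    congr 1
    refine hr (funext fun k => ?_)
    rw [hsmul, Equiv.swap_inv, Equiv.swap_apply_def]
    split_ifs with h1 h2
    · rw [h1, hij]
    · rw [h2, hij]
    · rfl

end labelled

/-- The key fact of James's theory: a tabloid either has two entries of one row in a common column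
of t, and is killed, or is a column translate of the tabloid of t, and goes to ± the polytabloid. -/
theorem antisymmetrizer_permRep (t : Tableau n μ) (v : MonoidAlgebra ℂ (Tabloid n μ)) :
    ∃ c : ℂ, antisymmetrizer (permRep n μ) t v = c • polytabloid t := by
  induction v using MonoidAlgebra.induction_linear with
  | zero => exact ⟨0, by simp⟩
  | add x y hx hy =>
    obtain ⟨a, ha⟩ := hx
    obtain ⟨b, hb⟩ := hy
    exact ⟨a + b, by rw [map_add, ha, hb, add_smul]⟩
  | single T a =>
    have ha : MonoidAlgebra.single T a = a • MonoidAlgebra.single T (1 : ℂ) := by simp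
    rw [ha, map_smul]
    have hdom : ∀ (T : Tabloid n μ) k, #{i | Tableau.row t i < k} ≤ #{i | T.row i < k} := by
      intro T k
      refine le_of_eq ?_
      have : ∀ f : Fin n → ℕ, #{i | f i < k} = ∑ j ∈ range k, #{i | f i = j} := by
        intro f
        rw [card_eq_sum_card_fiberwise (f := f) (t := range k)]
        · refine sum_congr rfl fun j hj => ?_
          rw [filter_filter]
          congr 1
          ext i
          simp only [mem_filter, mem_univ, true_and, and_iff_right_iff_imp]
          rintro rfl
          simpa using hj
        · intro i hi
          simpa using hi
      rw [this, this]
      refine sum_congr rfl fun j _ => ?_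
      rw [T.card_row, Tableau.card_row]
    rcases antisymmetrizer_single Tabloid.row (fun _ _ => Tabloid.ext)
      (fun g T i => Tabloid.smul_row g T i) t hdom T with h | ⟨π, hπ, h⟩
    · exact ⟨0, by rw [h]; simp⟩
    · refine ⟨a * ((Equiv.Perm.sign π : ℤ) : ℂ), ?_⟩
      have hT : T = π • Tableau.tabloid t := by
        rw [← inv_smul_eq_iff]
        exact Tabloid.ext h
      have := antisymmetrizer_smul (permRep n μ) hπ
        (MonoidAlgebra.single (Tableau.tabloid t) (1 : ℂ))
      rw [Representation.ofMulAction_single, ← polytabloid_eq_antisymmetrizer, ← hT] at this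
      rw [this, smul_smul]

end Specht
end

/-! ### Irreducibility of Specht modules and intertwining maps out of them. -/

noncomputable section

namespace Specht

open Finset

variable {n : ℕ} {μ : YoungDiagram}

instance : Finite (Tabloid n μ) := by
  have hb : ∀ (T : Tabloid n μ) i, T.row i < μ.colLen 0 := by
    intro T i
    have h : 0 < μ.rowLen (T.row i) := by
      rw [← T.card_row (T.row i)]
      exact card_pos.2 ⟨i, by simp⟩
    rwa [← YoungDiagram.mem_iff_lt_colLen, YoungDiagram.mem_iff_lt_rowLen]
  refine Finite.of_injective
    (fun (T : Tabloid n μ) (i : Fin n) => (⟨T.row i, hb T i⟩ : Fin (μ.colLen 0))) ?_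
  intro T T' h
  refine Tabloid.ext (funext fun i => ?_)
  exact congrArg Fin.val (congrFun h i)

theorem Tableau.exists_permute (t s : Tableau n μ) : ∃ σ, s = Tableau.permute σ t :=
  ⟨t.symm.trans s, by ext; simp [Tableau.permute]⟩

theorem coeff_antisymmetrizer (t : Tableau n μ) (v : MonoidAlgebra ℂ (Tabloid n μ))
    (T : Tabloid n μ) : (antisymmetrizer (permRep n μ) t v).coeff T =
      ∑ π ∈ Tableau.colStabilizer t, ((Equiv.Perm.sign π : ℤ) : ℂ) * v.coeff (π⁻¹ • T) := by
  rw [antisymmetrizer_apply, MonoidAlgebra.coeff_sum, Finsupp.finsetSum_apply]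
  refine sum_congr rfl fun π _ => ?_
  rw [MonoidAlgebra.coeff_smul_apply, Representation.coeff_ofMulAction, smul_eq_mul]

theorem star_coeff_antisymmetrizer (t : Tableau n μ) {v : MonoidAlgebra ℂ (Tabloid n μ)}
    (hv : ∀ T, star (v.coeff T) = v.coeff T) (T : Tabloid n μ) :
    star ((antisymmetrizer (permRep n μ) t v).coeff T) =
      (antisymmetrizer (permRep n μ) t v).coeff T := by
  rw [coeff_antisymmetrizer, star_sum]
  refine sum_congr rfl fun π _ => ?_
  rw [star_mul', hv]
  simp

theorem star_coeff_polytabloid (t : Tableau n μ) (T : Tabloid n μ) :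
    star ((polytabloid t).coeff T) = (polytabloid t).coeff T := by
  classical
  rw [polytabloid_eq_antisymmetrizer]
  refine star_coeff_antisymmetrizer t (fun T => ?_) T
  rw [MonoidAlgebra.coeff_single, Finsupp.single_apply]
  split_ifs <;> simp

theorem coeff_polytabloid_self (t : Tableau n μ) :
    (polytabloid t).coeff (Tableau.tabloid t) = 1 := by
  classical
  rw [polytabloid_eq_antisymmetrizer, coeff_antisymmetrizer,
    sum_eq_single_of_mem 1 t.one_mem_colStabilizer]
  · simp
  · intro π hπ hne
    rw [MonoidAlgebra.coeff_single, Finsupp.single_apply, if_neg, mul_zero]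
    intro h
    refine hne (Equiv.ext fun i => t.ext_row_col ?_ (Tableau.mem_colStabilizer.1 hπ i))
    have := congrFun (congrArg Tabloid.row h) i
    rw [Tabloid.smul_row, inv_inv] at this
    exact this.symm

theorem polytabloid_mem (t : Tableau n μ) : polytabloid t ∈ (spechtModule n μ).toSubmodule :=
  Submodule.subset_span ⟨t, rfl⟩

/-- A polytabloid as an element of the Specht module. -/
def spechtVector (t : Tableau n μ) : (spechtModule n μ).toSubmodule := ⟨polytabloid t,
  polytabloid_mem t⟩

/-- The representation of the symmetric group on the Specht module of a Young diagram. -/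
abbrev rep (n : ℕ) (μ : YoungDiagram) :
    Representation ℂ (Perm (Fin n)) (spechtModule n μ).toSubmodule :=
  (spechtModule n μ).toRepresentation

/-- The inclusion of the Specht module into the permutation module on tabloids. -/
def inclusion (n : ℕ) (μ : YoungDiagram) : (rep n μ).IntertwiningMap (permRep n μ) :=
  (spechtModule n μ).toSubmodule.subtype.intertwiningMap_of_isIntertwiningMap _ _
    fun _ _ => rfl

theorem inclusion_apply (v : (spechtModule n μ).toSubmodule) :
    inclusion n μ v = (v : MonoidAlgebra ℂ (Tabloid n μ)) := rfl

theorem rep_spechtVector (σ : Perm (Fin n)) (t : Tableau n μ) :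
    rep n μ σ (spechtVector t) = spechtVector (Tableau.permute σ t) :=
  Subtype.ext (permRep_polytabloid σ t)

theorem span_spechtVector :
    Submodule.span ℂ (Set.range (spechtVector (n := n) (μ := μ))) = ⊤ := by
  rw [eq_top_iff]
  rintro ⟨v, hv⟩ -
  induction hv using Submodule.span_induction with
  | mem x hx =>
    obtain ⟨t, rfl⟩ := hx
    exact Submodule.subset_span ⟨t, rfl⟩
  | zero => exact Submodule.zero_mem _
  | add x y hx hy h1 h2 => exact Submodule.add_mem _ h1 h2
  | smul c x hx h => exact Submodule.smul_mem _ c h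

theorem eq_top_of_spechtVector_mem (U : Subrepresentation (rep n μ)) (t : Tableau n μ)
    (h : spechtVector t ∈ U.toSubmodule) : U = ⊤ := by
  refine Subrepresentation.toSubmodule_injective ?_
  change U.toSubmodule = ⊤
  rw [eq_top_iff, ← span_spechtVector, Submodule.span_le]
  rintro _ ⟨s, rfl⟩
  obtain ⟨σ, rfl⟩ := t.exists_permute s
  rw [← rep_spechtVector]
  exact U.apply_mem_toSubmodule σ h

theorem antisymmetrizer_mem {V : Type*} [AddCommGroup V] [Module ℂ V]
    {ρ : Representation ℂ (Perm (Fin n)) V} (U : Subrepresentation ρ) (t : Tableau n μ) {v : V}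
    (hv : v ∈ U.toSubmodule) : antisymmetrizer ρ t v ∈ U.toSubmodule := by
  rw [antisymmetrizer_apply]
  exact Submodule.sum_mem _ fun π _ => Submodule.smul_mem _ _ (U.apply_mem_toSubmodule π hv)

/-- The coefficient of κ_t u at the tabloid of t is the Hermitian product of u with the polytabloid
of t. So u is orthogonal to the whole Specht module, in particular to itself. -/
theorem eq_zero_of_antisymmetrizer_eq_zero (u : (spechtModule n μ).toSubmodule)
    (hu : ∀ t : Tableau n μ, antisymmetrizer (permRep n μ) t u = 0) : u = 0 := by
  classical
  have := Fintype.ofFinite (Tabloid n μ)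
  have key : ∀ v ∈ (spechtModule n μ).toSubmodule,
      ∑ T, (u : MonoidAlgebra ℂ (Tabloid n μ)).coeff T * star (v.coeff T) = 0 := by
    intro v hv
    induction hv using Submodule.span_induction with
    | mem x hx =>
      obtain ⟨t, rfl⟩ := hx
      have h := congrArg (fun w => w.coeff (Tableau.tabloid t)) (hu t)
      simp only [coeff_antisymmetrizer, MonoidAlgebra.coeff_zero, Finsupp.coe_zero,
        Pi.zero_apply] at h
      rw [← h]
      simp_rw [star_coeff_polytabloid]
      simp only [polytabloid_eq_antisymmetrizer, coeff_antisymmetrizer, mul_sum,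
        MonoidAlgebra.coeff_single, Finsupp.single_apply]
      rw [sum_comm]
      refine sum_bij (fun π _ => π⁻¹) (fun π hπ => Tableau.inv_mem_colStabilizer hπ)
        (fun π _ π' _ h => inv_injective h)
        (fun π hπ => ⟨π⁻¹, Tableau.inv_mem_colStabilizer hπ, inv_inv π⟩) fun π _ => ?_
      rw [sum_eq_single (π • Tableau.tabloid t)]
      · simp [mul_comm]
      · intro T _ hT
        rw [if_neg, mul_zero, mul_zero]
        rintro h
        exact hT (by rw [h, smul_inv_smul])
      · simp
    | zero => simp
    | add x y _ _ hx hy => simp only [MonoidAlgebra.coeff_add, Finsupp.add_apply, star_add, mul_add,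
        sum_add_distrib, hx, hy, add_zero]
    | smul c x _ hx =>
      simp only [MonoidAlgebra.coeff_smul_apply, smul_eq_mul, star_mul']
      simp_rw [mul_left_comm _ (star c)]
      rw [← mul_sum, hx, mul_zero]
  have h0 := key u u.2
  have h1 : ∀ T, (u : MonoidAlgebra ℂ (Tabloid n μ)).coeff T = 0 := by
    have h2 : ∑ T, Complex.normSq ((u : MonoidAlgebra ℂ (Tabloid n μ)).coeff T) = 0 := by
      have h3 : ((∑ T, Complex.normSq ((u : MonoidAlgebra ℂ (Tabloid n μ)).coeff T) : ℝ) : ℂ)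
          = 0 := by
        rw [← h0, Complex.ofReal_sum]
        exact sum_congr rfl fun T _ => (Complex.mul_conj _).symm
      exact_mod_cast h3
    intro T
    rw [sum_eq_zero_iff_of_nonneg fun T _ => Complex.normSq_nonneg _] at h2
    exact Complex.normSq_eq_zero.1 (h2 T (mem_univ T))
  refine Subtype.ext (MonoidAlgebra.ext (Finsupp.ext fun T => ?_))
  simpa using h1 T

theorem spechtVector_ne_zero (t : Tableau n μ) : spechtVector t ≠ 0 := by
  intro h
  have := congrArg (fun v => (inclusion n μ v).coeff (Tableau.tabloid t)) h
  rw [map_zero] at this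
  have h1 := coeff_polytabloid_self t
  rw [inclusion_apply] at this
  rw [show ((spechtVector t : (spechtModule n μ).toSubmodule) : MonoidAlgebra ℂ (Tabloid n μ)) =
    polytabloid t from rfl] at this
  simp [h1] at this

/-- Specht modules over `ℂ` are irreducible. -/
theorem rep_isIrreducible (t₀ : Tableau n μ) : (rep n μ).IsIrreducible := by
  refine @IsSimpleOrder.mk _ _ _ ?_ ?_
  · refine ⟨⟨⊥, ⊤, fun h => spechtVector_ne_zero t₀ ?_⟩⟩
    have h2 : spechtVector t₀ ∈ (⊤ : Subrepresentation (rep n μ)).toSubmodule :=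
      Submodule.mem_top
    rw [← h] at h2
    exact (Submodule.mem_bot ℂ).1 h2
  · intro U
    -- Either all signed column sums kill U, and then U = 0, or one of them sends a vector of U to a
    -- nonzero multiple of a polytabloid, which generates the module.
    by_cases h : ∀ u ∈ U.toSubmodule, ∀ t : Tableau n μ,
      antisymmetrizer (permRep n μ) t (inclusion n μ u) = 0
    · left
      refine Subrepresentation.toSubmodule_injective ?_
      change U.toSubmodule = ⊥
      rw [eq_bot_iff]
      intro u hu
      rw [Submodule.mem_bot]
      exact eq_zero_of_antisymmetrizer_eq_zero u (h u hu)
    · right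
      push Not at h
      obtain ⟨u, hu, t, ht⟩ := h
      refine eq_top_of_spechtVector_mem U t ?_
      obtain ⟨c, hc⟩ := antisymmetrizer_permRep t (inclusion n μ u)
      have hc0 : c ≠ 0 := by
        rintro rfl
        exact ht (by rw [hc, zero_smul])
      have h1 := antisymmetrizer_mem U t hu
      have h2 : antisymmetrizer (rep n μ) t u = c • spechtVector t := by
        refine Subtype.ext ?_
        rw [← inclusion_apply, ← antisymmetrizer_map, hc]
        rfl
      rw [h2] at h1
      exact (Submodule.smul_mem_iff _ hc0).1 h1

theorem antisymmetrizer_spechtVector (t : Tableau n μ) :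
    antisymmetrizer (rep n μ) t (spechtVector t) =
      ((Tableau.colStabilizer t).card : ℂ) • spechtVector t := by
  refine Subtype.ext ?_
  rw [← inclusion_apply, ← antisymmetrizer_map]
  exact antisymmetrizer_polytabloid t

section hom

variable {W : Type*} [AddCommGroup W] [Module ℂ W] {σ : Representation ℂ (Perm (Fin n)) W}

theorem intertwiningMap_ext (t : Tableau n μ) {θ η : (rep n μ).IntertwiningMap σ}
    (h : θ (spechtVector t) = η (spechtVector t)) : θ = η := by
  refine Representation.IntertwiningMap.ext (LinearMap.ext_on span_spechtVector ?_)
  rintro _ ⟨s, rfl⟩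
  obtain ⟨g, rfl⟩ := t.exists_permute s
  rw [← rep_spechtVector, Representation.IntertwiningMap.toLinearMap_apply,
    Representation.IntertwiningMap.toLinearMap_apply, θ.isIntertwining, η.isIntertwining, h]

/-- A polytabloid is, up to the order of the column stabilizer, fixed by its own signed column sum,
so its image lies in the range of that operator on the target. This is how Hom spaces are bounded.
-/
theorem intertwiningMap_spechtVector (t : Tableau n μ) (θ : (rep n μ).IntertwiningMap σ) :
    θ (spechtVector t) = ((Tableau.colStabilizer t).card : ℂ)⁻¹ •
      antisymmetrizer σ t (θ (spechtVector t)) := by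
  rw [antisymmetrizer_map, antisymmetrizer_spechtVector, map_smul, smul_smul,
    inv_mul_cancel₀ t.card_colStabilizer_ne_zero, one_smul]

theorem intertwiningMap_eq_zero (t : Tableau n μ) (h : antisymmetrizer σ t = 0)
    (θ : (rep n μ).IntertwiningMap σ) : θ = 0 := by
  refine intertwiningMap_ext t ?_
  rw [intertwiningMap_spechtVector, h]
  simp

end hom

theorem intertwiningMap_permRep (t : Tableau n μ) (θ : (rep n μ).IntertwiningMap (permRep n μ)) :
    ∃ c : ℂ, θ = c • inclusion n μ := by
  obtain ⟨c, hc⟩ := antisymmetrizer_permRep t (θ (spechtVector t))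
  refine ⟨((Tableau.colStabilizer t).card : ℂ)⁻¹ * c, intertwiningMap_ext t ?_⟩
  rw [intertwiningMap_spechtVector, hc, smul_smul]
  rfl

theorem finrank_intertwiningMap_permRep (t : Tableau n μ) :
    Module.finrank ℂ ((rep n μ).IntertwiningMap (permRep n μ)) = 1 := by
  refine finrank_eq_one (inclusion n μ) ?_ ?_
  · intro h
    have := congrArg (fun θ => θ (spechtVector t)) h
    refine spechtVector_ne_zero t (Subtype.ext ?_)
    exact this
  · intro θ
    obtain ⟨c, hc⟩ := intertwiningMap_permRep t θ
    exact ⟨c, hc.symm⟩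

/-! ### Reality of the characters. -/

section real

/-- The functional pairing a vector with the polytabloid of `t`. -/
def pairing (t : Tableau n μ) : MonoidAlgebra ℂ (Tabloid n μ) →ₗ[ℂ] ℂ :=
  (Finsupp.lapply (Tableau.tabloid t)) ∘ₗ
    (MonoidAlgebra.coeffLinearEquiv ℂ).toLinearMap ∘ₗ antisymmetrizer (permRep n μ) t

theorem pairing_apply (t : Tableau n μ) (v : MonoidAlgebra ℂ (Tabloid n μ)) :
    pairing t v = (antisymmetrizer (permRep n μ) t v).coeff (Tableau.tabloid t) := rfl

theorem pairing_permute (g : Perm (Fin n)) (t : Tableau n μ)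
    (v : MonoidAlgebra ℂ (Tabloid n μ)) :
    pairing (Tableau.permute g t) (permRep n μ g v) = pairing t v := by
  rw [pairing_apply, pairing_apply, coeff_antisymmetrizer, coeff_antisymmetrizer]
  symm
  refine sum_bij (fun π _ => g * π * g⁻¹) ?_ ?_ ?_ ?_
  · intro π hπ
    rw [Tableau.mem_colStabilizer] at hπ ⊢
    intro i
    simp [Tableau.col_permute, hπ]
  · intro π _ π' _ h
    simpa using h
  · intro π hπ
    refine ⟨g⁻¹ * π * g, ?_, by group⟩
    rw [Tableau.mem_colStabilizer] at hπ ⊢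
    intro i
    simpa [Tableau.col_permute] using hπ (g i)
  · intro π _
    rw [Representation.coeff_ofMulAction, Tableau.tabloid_permute, smul_smul, smul_smul]
    congr 2
    · rcases Int.units_eq_one_or (Equiv.Perm.sign g) with h | h <;> simp [h]
    · group

/-- The equivariant operator `v ↦ ∑ t, ⟨e_t, v⟩ e_t` on the permutation module. -/
def gramOperator (n : ℕ) (μ : YoungDiagram) :
    MonoidAlgebra ℂ (Tabloid n μ) →ₗ[ℂ] MonoidAlgebra ℂ (Tabloid n μ) :=
  ∑ t : Tableau n μ, (pairing t).smulRight (polytabloid t)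

theorem gramOperator_apply (v : MonoidAlgebra ℂ (Tabloid n μ)) :
    gramOperator n μ v = ∑ t : Tableau n μ, pairing t v • polytabloid t := by
  simp [gramOperator]

theorem gramOperator_permRep (g : Perm (Fin n)) (v : MonoidAlgebra ℂ (Tabloid n μ)) :
    gramOperator n μ (permRep n μ g v) = permRep n μ g (gramOperator n μ v) := by
  rw [gramOperator_apply, gramOperator_apply, map_sum]
  symm
  refine sum_bijective (Tableau.permute g) ?_ (by simp) ?_
  · refine Function.bijective_iff_has_inverse.2 ⟨Tableau.permute g⁻¹, fun t => ?_, fun t => ?_⟩ <;>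
    · ext
      simp [Tableau.permute]
  · intro t _
    rw [map_smul, permRep_polytabloid, pairing_permute]

theorem gramOperator_mem (v : MonoidAlgebra ℂ (Tabloid n μ)) :
    gramOperator n μ v ∈ (spechtModule n μ).toSubmodule := by
  rw [gramOperator_apply]
  exact Submodule.sum_mem _ fun t _ => Submodule.smul_mem _ _ (polytabloid_mem t)

theorem trace_comp_gramOperator (g : Perm (Fin n)) :
    LinearMap.trace ℂ _ (permRep n μ g ∘ₗ gramOperator n μ) =
      ∑ t : Tableau n μ, pairing t (polytabloid (Tableau.permute g t)) := by
  have h : permRep n μ g ∘ₗ gramOperator n μ = ∑ t : Tableau n μ,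
      dualTensorHom ℂ _ _ ((pairing t) ⊗ₜ[ℂ] (polytabloid (Tableau.permute g t))) := by
    refine LinearMap.ext fun v => ?_
    simp [gramOperator_apply, map_sum, permRep_polytabloid]
  rw [h, map_sum]
  refine sum_congr rfl fun t _ => ?_
  rw [LinearMap.trace_eq_contract_apply]
  simp

/-- The Gram operator is equivariant with range in the Specht module, so multiplicity one makes it a
scalar c there. The trace of its product with g is then c χ(g), and it is also a sum of explicit
pairings of polytabloids. -/
theorem gramOperator_spec (t : Tableau n μ) : ∃ c : ℂ, ∀ g : Perm (Fin n),
    c * (rep n μ).character g =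
      ∑ t : Tableau n μ, pairing t (polytabloid (Tableau.permute g t)) := by
  obtain ⟨c, hc⟩ := intertwiningMap_permRep t
    ⟨gramOperator n μ ∘ₗ (spechtModule n μ).toSubmodule.subtype, fun g => LinearMap.ext fun v =>
      gramOperator_permRep g (v : MonoidAlgebra ℂ (Tabloid n μ))⟩
  refine ⟨c, fun g => ?_⟩
  have hmem : ∀ v, (permRep n μ g ∘ₗ gramOperator n μ) v ∈ (spechtModule n μ).toSubmodule :=
    fun v => (spechtModule n μ).apply_mem_toSubmodule g (gramOperator_mem v)
  rw [← trace_comp_gramOperator, ← LinearMap.trace_restrict_eq_of_forall_mem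
    (spechtModule n μ).toSubmodule _ hmem]
  rw [Representation.character, ← smul_eq_mul, ← map_smul]
  congr 1
  refine LinearMap.ext fun v => Subtype.ext ?_
  have h1 : gramOperator n μ v = c • (v : MonoidAlgebra ℂ (Tabloid n μ)) :=
    congrArg (fun θ => θ v) hc
  change c • permRep n μ g v = permRep n μ g (gramOperator n μ v)
  rw [h1, map_smul]

/-- The pairings of polytabloids are real. At g = 1 they sum to a positive integer, so the scalar c
is real and nonzero and can be cancelled. -/
theorem star_character (t : Tableau n μ) (g : Perm (Fin n)) :
    star ((rep n μ).character g) = (rep n μ).character g := by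
  obtain ⟨c, hc⟩ := gramOperator_spec t
  have h1 : c * (Module.finrank ℂ (spechtModule n μ).toSubmodule : ℂ) =
      ((∑ t : Tableau n μ, (Tableau.colStabilizer t).card : ℕ) : ℂ) := by
    rw [← Representation.char_one (rep n μ), hc 1, Nat.cast_sum]
    refine sum_congr rfl fun t _ => ?_
    rw [show Tableau.permute 1 t = t from rfl, pairing_apply, antisymmetrizer_polytabloid,
      MonoidAlgebra.coeff_smul_apply, coeff_polytabloid_self]
    simp
  have h2 : ((∑ t : Tableau n μ, (Tableau.colStabilizer t).card : ℕ) : ℂ) ≠ 0 := by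
    rw [Nat.cast_ne_zero]
    refine (sum_pos (fun t _ => card_pos.2 ⟨1, t.one_mem_colStabilizer⟩) ⟨t, mem_univ t⟩).ne'
  have hd : (Module.finrank ℂ (spechtModule n μ).toSubmodule : ℂ) ≠ 0 :=
    fun h => h2 (by rw [← h1, h, mul_zero])
  have hc0 : c ≠ 0 := fun h => h2 (by rw [← h1, h, zero_mul])
  have hcs : star c = c := by
    refine mul_right_cancel₀ hd ?_
    rw [h1]
    have := congrArg star h1
    rwa [star_mul', star_natCast, star_natCast] at this
  refine mul_left_cancel₀ hc0 ?_
  conv_lhs => rw [← hcs]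
  rw [← star_mul', hc g, star_sum]
  refine sum_congr rfl fun s _ => ?_
  rw [pairing_apply]
  exact star_coeff_antisymmetrizer s (star_coeff_polytabloid _) _

end real

end Specht
end

/-! ### The cycle index of the symmetric group. -/

noncomputable section

namespace Specht

open Finset

section cycleIndex

variable {α : Type*} [Fintype α] [DecidableEq α]

/-- The class of `a` under `SameCycle`. -/
abbrev CycleClass (g : Perm α) : Type _ := Quotient (Equiv.Perm.SameCycle.setoid g)

instance (g : Perm α) : Fintype (CycleClass g) := by classical exact Quotient.fintype _

open scoped Classical in
-- Indexing by the orbits of g treats nontrivial cycles and fixed points uniformly, whereas the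
-- cycle partition is defined from the two separately.
theorem prod_map_partition {R : Type*} [CommMonoid R] (g : Perm α) (F : ℕ → R) :
    (g.partition.parts.map F).prod =
      ∏ q : CycleClass g, F (#{a | (⟦a⟧ : CycleClass g) = q}) := by
  have hmk : ∀ a b : α, (⟦a⟧ : CycleClass g) = ⟦b⟧ ↔ g.SameCycle a b :=
    fun a b => Quotient.eq
  rw [Equiv.Perm.parts_partition, Multiset.map_add, Multiset.prod_add, Multiset.map_replicate,
    Multiset.prod_replicate, Equiv.Perm.cycleType_def, Multiset.map_map,
    ← prod_filter_mul_prod_filter_not univ (fun q : CycleClass g => g q.out ≠ q.out)]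
  congr 1
  · symm
    change _ = ∏ c ∈ g.cycleFactorsFinset, F (#c.support)
    refine prod_bij (fun q _ => g.cycleOf q.out) ?_ ?_ ?_ ?_
    · intro q hq
      rw [Equiv.Perm.cycleOf_mem_cycleFactorsFinset_iff, Equiv.Perm.mem_support]
      exact (mem_filter.1 hq).2
    · intro q hq q' hq' h
      have h1 : q.out ∈ (g.cycleOf q'.out).support := by
        rw [← h, Equiv.Perm.mem_support_cycleOf_iff, Equiv.Perm.mem_support]
        exact ⟨Equiv.Perm.SameCycle.refl _ _, (mem_filter.1 hq).2⟩
      rw [Equiv.Perm.mem_support_cycleOf_iff] at h1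
      rw [← q.out_eq, ← q'.out_eq, hmk]
      exact h1.1.symm
    · intro c hc
      obtain ⟨a, ha⟩ := (Equiv.Perm.mem_cycleFactorsFinset_iff.1 hc).1.nonempty_support
      have hca := Equiv.Perm.cycle_is_cycleOf ha hc
      have hs : g.SameCycle (⟦a⟧ : CycleClass g).out a := by
        rw [← hmk, Quotient.out_eq]
      refine ⟨⟦a⟧, mem_filter.2 ⟨mem_univ _, ?_⟩, ?_⟩
      · have hga : a ∈ g.support := Equiv.Perm.mem_cycleFactorsFinset_support_le hc ha
        rw [Equiv.Perm.mem_support] at hga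
        exact fun h => hga ((hs.apply_eq_self_iff).1 h)
      · rw [hca]
        exact hs.cycleOf_eq
    · intro q hq
      congr 2
      ext a
      rw [mem_filter, Equiv.Perm.mem_support_cycleOf_iff, Equiv.Perm.mem_support]
      constructor
      · rintro ⟨-, h⟩
        refine ⟨?_, (mem_filter.1 hq).2⟩
        rw [← hmk, Quotient.out_eq, h]
      · rintro ⟨h, -⟩
        refine ⟨mem_univ _, ?_⟩
        rw [← q.out_eq, hmk]
        exact h.symm
  · have hfix : ∀ {a b : α}, g a = a → g.SameCycle a b → b = a := by
      rintro a b ha ⟨i, rfl⟩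
      exact Equiv.Perm.zpow_apply_eq_self_of_apply_eq_self ha i
    rw [prod_congr rfl (g := fun _ => F 1), prod_const]
    · congr 1
      rw [← card_compl]
      refine card_bij (fun a _ => ⟦a⟧) ?_ ?_ ?_
      · intro a ha
        have ha' : g a = a := by simpa using ha
        have : (⟦a⟧ : CycleClass g).out = a := by
          refine hfix ha' ?_
          rw [← hmk, Quotient.out_eq]
        simp [this, ha']
      · intro a ha b hb h
        have ha' : g a = a := by simpa using ha
        exact (hfix ha' ((hmk a b).1 h)).symm
      · intro q hq
        refine ⟨q.out, ?_, q.out_eq⟩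
        simpa using hq
    · intro q hq
      have hq' : g q.out = q.out := by simpa using hq
      congr 1
      rw [card_eq_one]
      refine ⟨q.out, ?_⟩
      ext a
      rw [mem_filter, mem_singleton]
      constructor
      · rintro ⟨-, h⟩
        refine hfix hq' ?_
        rw [← hmk, Quotient.out_eq, h]
      · rintro rfl
        exact ⟨mem_univ _, q.out_eq⟩

open scoped Classical in
/-- The product of power sums over the cycles of `g` enumerates the labellings fixed by `g`. -/
theorem prod_powerSum_partition {R ι : Type*} [CommSemiring R] [Fintype ι] [DecidableEq ι]
    (g : Perm α) (z : ι → R) : (g.partition.parts.map fun c => ∑ i, z i ^ c).prod =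
      ∑ f : α → ι with f ∘ g = f, ∏ a, z (f a) := by
  -- Expanding the product picks one label for each cycle, which is the same as a labelling constant
  -- on cycles.
  rw [prod_map_partition, prod_univ_sum]
  refine sum_bij (fun F _ => fun a => F ⟦a⟧) ?_ ?_ ?_ ?_
  · intro F _
    refine mem_filter.2 ⟨mem_univ _, funext fun a => ?_⟩
    change F _ = F _
    congr 1
    exact Quotient.sound (Equiv.Perm.sameCycle_apply_left.2 (Equiv.Perm.SameCycle.refl _ _))
  · intro F _ F' _ h
    refine funext fun q => ?_
    rw [← q.out_eq]
    exact congrFun h q.out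
  · intro f hf
    have hf' := (mem_filter.1 hf).2
    refine ⟨fun q => f q.out, by simp, funext fun a => ?_⟩
    have hs : g.SameCycle a (⟦a⟧ : CycleClass g).out :=
      Quotient.exact (s := Equiv.Perm.SameCycle.setoid g) (Quotient.out_eq _).symm
    obtain ⟨i, hi⟩ := hs
    change f (⟦a⟧ : CycleClass g).out = f a
    rw [← hi]
    have hpow : ∀ (k : ℕ) (b : α), f ((g ^ k) b) = f b := by
      intro k
      induction k with
      | zero => simp
      | succ k ih =>
        intro b
        rw [pow_succ, Equiv.Perm.mul_apply, ih]
        exact congrFun hf' b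
    obtain ⟨k, rfl | rfl⟩ := i.eq_nat_or_neg
    · rw [zpow_natCast, hpow]
    · rw [zpow_neg, zpow_natCast]
      simpa using (hpow k ((g ^ k)⁻¹ a)).symm
  · intro F _
    rw [← prod_fiberwise univ (fun a => (⟦a⟧ : CycleClass g))]
    refine prod_congr rfl fun q _ => ?_
    rw [prod_congr rfl (g := fun _ => z (F q)), prod_const]
    intro a ha
    change z (F ⟦a⟧) = _
    rw [(mem_filter.1 ha).2]

end cycleIndex

section content

open scoped Classical

variable {n : ℕ} {ι : Type*} [Fintype ι]

/-- The number of times that `f` takes each value. -/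
def content (f : Fin n → ι) : ι →₀ ℕ := Finsupp.equivFunOnFinite.symm fun i => #{a | f a = i}

theorem content_apply (f : Fin n → ι) (i : ι) : content f i = #{a | f a = i} := rfl

theorem prod_eq_prod_pow_content {R : Type*} [CommMonoid R] (f : Fin n → ι) (z : ι → R) :
    ∏ a, z (f a) = ∏ i, z i ^ content f i := by
  rw [← prod_fiberwise univ f]
  refine prod_congr rfl fun i _ => ?_
  rw [prod_congr rfl (g := fun _ => z i), prod_const, content_apply]
  intro a ha
  rw [(mem_filter.1 ha).2]

theorem content_mem_antidiag (f : Fin n → ι) : content f ∈ finsuppAntidiag univ n := by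
  rw [mem_finsuppAntidiag]
  refine ⟨?_, by simp⟩
  change ∑ i, #{a | f a = i} = n
  have h := card_eq_sum_card_fiberwise (s := univ) (t := univ) (f := f) (fun _ _ => by simp)
  rw [card_univ, Fintype.card_fin] at h
  exact h.symm

theorem exists_content_eq {N : ι →₀ ℕ} (hN : N ∈ finsuppAntidiag univ n) :
    ∃ f : Fin n → ι, content f = N := by
  rw [mem_finsuppAntidiag] at hN
  have hcard : Fintype.card (Σ i, Fin (N i)) = n := by simp [hN.1]
  let e : Fin n ≃ Σ i, Fin (N i) := (Fintype.equivFinOfCardEq hcard).symm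
  refine ⟨fun a => (e a).1, Finsupp.ext fun i => ?_⟩
  rw [content_apply, ← Fintype.card_fin (N i), ← card_univ]
  symm
  refine card_bij (fun k _ => e.symm ⟨i, k⟩) ?_ ?_ ?_
  · intro k _
    simp
  · intro k _ k' _ h
    simpa using h
  · intro a ha
    have ha' : (e a).1 = i := by simpa using ha
    subst ha'
    exact ⟨(e a).2, mem_univ _, by simp⟩

theorem exists_perm_of_content_eq {f f' : Fin n → ι} (h : content f = content f') :
    ∃ σ : Perm (Fin n), f ∘ σ = f' := by
  have hc : ∀ i, Nonempty ({a // f' a = i} ≃ {a // f a = i}) := by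
    intro i
    rw [← Fintype.card_eq, Fintype.card_subtype, Fintype.card_subtype]
    exact (DFunLike.congr_fun h i).symm
  refine ⟨Equiv.ofFiberEquiv (f := f') (g := f) fun i => (hc i).some, funext fun a => ?_⟩
  exact Equiv.ofFiberEquiv_map _ a

/-- Orbit counting: labellings of one content form a single orbit. The stabilizer of f has the size
of the coset of permutations carrying f₀ to f, and these cosets partition S_n. -/
theorem sum_card_stabilizer {N : ι →₀ ℕ} (hN : N ∈ finsuppAntidiag univ n) :
    ∑ f : Fin n → ι with content f = N, #{g : Perm (Fin n) | f ∘ g = f} = n.factorial := by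
  obtain ⟨f₀, h₀⟩ := exists_content_eq hN
  have h1 : ∀ f ∈ univ.filter (fun f : Fin n → ι => content f = N),
      #{g : Perm (Fin n) | f ∘ g = f} = #{g : Perm (Fin n) | f₀ ∘ g = f} := by
    intro f hf
    obtain ⟨σ, rfl⟩ := exists_perm_of_content_eq (h₀.trans (mem_filter.1 hf).2.symm)
    refine card_bij (fun g _ => σ * g) ?_ ?_ ?_
    · intro g hg
      refine mem_filter.2 ⟨mem_univ _, ?_⟩
      exact (mem_filter.1 hg).2
    · intro g _ g' _ h
      exact mul_left_cancel h
    · intro g hg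
      refine ⟨σ⁻¹ * g, mem_filter.2 ⟨mem_univ _, ?_⟩, by simp⟩
      funext a
      simpa using congrFun (mem_filter.1 hg).2 a
  rw [sum_congr rfl h1, ← card_eq_sum_card_fiberwise (f := fun g : Perm (Fin n) => f₀ ∘ g)]
  · rw [card_univ, Fintype.card_perm, Fintype.card_fin]
  · intro g _
    simp only [coe_filter, mem_univ, true_and, Set.mem_ofPred_eq]
    rw [← h₀]
    refine Finsupp.ext fun i => ?_
    rw [content_apply, content_apply]
    refine card_bij (fun a _ => g a) ?_ ?_ ?_
    · intro a ha
      simpa using ha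
    · intro a _ b _ h
      exact g.injective h
    · intro b hb
      exact ⟨g⁻¹ b, by simpa using hb, by simp⟩

/-- The cycle index of the symmetric group is the complete homogeneous symmetric polynomial. -/
theorem sum_prod_powerSum_partition {R : Type*} [CommSemiring R] (z : ι → R) :
    ∑ g : Perm (Fin n), (g.partition.parts.map fun c => ∑ i, z i ^ c).prod =
      (n.factorial : R) * ∑ N ∈ finsuppAntidiag univ n, ∏ i, z i ^ N i := by
  simp_rw [prod_powerSum_partition, sum_filter]
  rw [sum_comm, ← sum_fiberwise_of_maps_to (fun f _ => content_mem_antidiag (n := n) (ι := ι) f),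
    mul_sum]
  refine sum_congr rfl fun N hN => ?_
  rw [← sum_card_stabilizer hN, Nat.cast_sum, sum_mul]
  refine sum_congr rfl fun f hf => ?_
  rw [← sum_filter, sum_const, prod_eq_prod_pow_content, (mem_filter.1 hf).2, nsmul_eq_mul]

end content

end Specht
end

/-! ### Cauchy's determinant and the Cauchy identity. -/

noncomputable section

namespace Specht

open Finset

section cauchy

variable {R : Type*} [CommRing R]

/-- Cauchy's determinant identity. -/
theorem det_cauchy {m : ℕ} (x y : Fin m → R) (c : Fin m → Fin m → R)
    (hc : ∀ i j, c i j * (1 - x i * y j) = 1) :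
    (Matrix.of c).det = (∏ i, ∏ j ∈ Ioi i, (x j - x i)) * (∏ i, ∏ j ∈ Ioi i, (y j - y i)) *
      ∏ i, ∏ j, c i j := by
  induction m with
  | zero => simp
  | succ m ih =>
    let B : Matrix (Fin (m + 1)) (Fin (m + 1)) R := Matrix.of fun i j =>
      if i = 0 then c 0 j else (x i - x 0) * (y j - y 0) * (c i j * c i 0 * c 0 j)
    have h1 : (Matrix.of c).det = B.det := by
      -- Since 1 - x_0 y_0 is the inverse of c_00, this subtracts from row i the multiple c_i0 /
      -- c_00 of row 0. The remaining entries acquire the factor (x_i - x_0)(y_j - y_0), so column 0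
      -- vanishes below the top.
      refine Matrix.det_eq_of_forall_row_eq_smul_add_const
        (fun i => if i = 0 then 0 else c i 0 * (1 - x 0 * y 0)) 0 (by simp) fun i j => ?_
      by_cases hi : i = 0
      · simp [B, hi]
      · simp only [Matrix.of_apply, B, hi, if_false, if_true]
        linear_combination (c i 0 * (1 - x 0 * y 0) * c 0 j) * hc i j -
          c i j * (c 0 j * (1 - x 0 * y j)) * hc i 0 - c i j * hc 0 j
    have h2 : B.submatrix (Fin.succAbove 0) Fin.succ = Matrix.of fun i j : Fin m =>
        ((x i.succ - x 0) * c i.succ 0) *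
          (Matrix.of (fun i j : Fin m => ((y j.succ - y 0) * c 0 j.succ) *
            (Matrix.of fun i j : Fin m => c i.succ j.succ) i j) i j) := by
      ext i j
      simp only [B, Matrix.submatrix_apply, Matrix.of_apply, Fin.succAbove_zero, Fin.succ_ne_zero,
        if_false]
      ring
    rw [h1, Matrix.det_succ_column_zero, Finset.sum_eq_single 0]
    · rw [h2, Matrix.det_mul_column, Matrix.det_mul_row,
        ih (fun i => x i.succ) (fun j => y j.succ) (fun i j => c i.succ j.succ)
          fun i j => hc i.succ j.succ]
      simp only [Fin.prod_univ_succ, Fin.prod_Ioi_zero, Fin.prod_Ioi_succ, prod_mul_distrib]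
      simp only [B, Matrix.of_apply, if_true, Fin.val_zero, pow_zero, one_mul]
      ring
    · intro i _ hi
      simp [B, hi]
    · simp

/-- The alternant `det (x_i ^ (m - 1 - j))`. -/
def alternant {m : ℕ} (x : Fin m → R) : R := (Matrix.of fun i j : Fin m => x i ^ (j.rev : ℕ)).det

theorem map_alternant {S : Type*} [CommRing S] (φ : R →+* S) {m : ℕ} (x : Fin m → R) :
    φ (alternant x) = alternant fun i => φ (x i) := by
  rw [alternant, alternant, RingHom.map_det]
  congr 1
  ext i j
  simp

/-- Each alternant is a Vandermonde determinant up to the sign of reversing the columns; that sign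
occurs twice. -/
theorem alternant_mul_alternant {m : ℕ} (x y : Fin m → R) : alternant x * alternant y =
    (∏ i, ∏ j ∈ Ioi i, (x j - x i)) * (∏ i, ∏ j ∈ Ioi i, (y j - y i)) := by
  have h : ∀ x : Fin m → R, alternant x =
      ((Equiv.Perm.sign (Fin.revPerm : Perm (Fin m)) : ℤ) : R) * (Matrix.vandermonde x).det := by
    intro x
    rw [← Matrix.det_permute']
    rfl
  rw [h, h, ← Matrix.det_vandermonde, ← Matrix.det_vandermonde]
  rcases Int.units_eq_one_or (Equiv.Perm.sign (Fin.revPerm : Perm (Fin m))) with h | h <;>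
    simp [h]

/-- The Cauchy identity, degree by degree. -/
theorem alternant_mul_alternant_mul_sum {m : ℕ} (x y : Fin m → R) (n : ℕ) :
    alternant x * alternant y *
        ∑ N ∈ finsuppAntidiag (univ : Finset (Fin m × Fin m)) n, ∏ p, (x p.1 * y p.2) ^ N p =
      ∑ w : Perm (Fin m), ((Equiv.Perm.sign w : ℤ) : R) *
        ∑ N ∈ finsuppAntidiag univ (n + ∑ i : Fin m, #(Ioi i)), ∏ i, (x (w i) * y i) ^ N i := by
  -- Geometric series for 1 / (1 - T x_i y_j), where the formal variable T records the degree and is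
  -- absorbed into x_i.
  let c : Fin m → Fin m → PowerSeries R := fun i j => PowerSeries.mk fun k => (x i * y j) ^ k
  have hc : ∀ i j, c i j * (1 - (PowerSeries.X * PowerSeries.C (x i)) * PowerSeries.C (y j)) =
      1 := by
    intro i j
    have h0 : c i j * (1 - (PowerSeries.X * PowerSeries.C (x i)) * PowerSeries.C (y j)) =
        c i j - (c i j * PowerSeries.C (x i * y j)) * PowerSeries.X := by
      rw [map_mul]
      ring
    rw [h0]
    ext k
    rw [map_sub, PowerSeries.coeff_one]
    cases k with
    | zero => simp [c]
    | succ k =>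
      rw [PowerSeries.coeff_succ_mul_X, PowerSeries.coeff_mul_C]
      simp [c, pow_succ]
  have h := congrArg (PowerSeries.coeff (n + ∑ i : Fin m, #(Ioi i))) (det_cauchy _ _ c hc)
  -- The Vandermonde product in the variables T x_i carries one T for each pair i < j; this is the
  -- degree shift on the right of the identity.
  have hV : (∏ i : Fin m, ∏ j ∈ Ioi i,
      (PowerSeries.X * PowerSeries.C (x j) - PowerSeries.X * PowerSeries.C (x i))) =
      PowerSeries.X ^ (∑ i : Fin m, #(Ioi i)) *
        PowerSeries.C (∏ i, ∏ j ∈ Ioi i, (x j - x i)) := by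
    simp_rw [← mul_sub, prod_mul_distrib, prod_const, prod_pow_eq_pow_sum, map_prod, map_sub]
  have hW : (∏ i : Fin m, ∏ j ∈ Ioi i, (PowerSeries.C (y j) - PowerSeries.C (y i))) =
      PowerSeries.C (∏ i, ∏ j ∈ Ioi i, (y j - y i)) := by
    simp_rw [map_prod, map_sub]
  rw [hV, hW, mul_assoc, mul_assoc, PowerSeries.coeff_X_pow_mul, ← mul_assoc,
    ← map_mul, ← alternant_mul_alternant, PowerSeries.coeff_C_mul, ← Fintype.prod_prod_type',
    PowerSeries.coeff_prod] at h
  simp only [c, PowerSeries.coeff_mk] at h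
  rw [← h, Matrix.det_apply', map_sum]
  refine sum_congr rfl fun w _ => ?_
  rw [← map_intCast (PowerSeries.C (R := R)), PowerSeries.coeff_C_mul, PowerSeries.coeff_prod]
  simp

end cauchy

/-! ### The norm of Frobenius's class function. -/

section norm

open MvPolynomial

variable {m n : ℕ}

/-- Frobenius's generating polynomial of the character values at `g`. -/
def frobeniusPoly (m : ℕ) (g : Perm (Fin n)) : MvPolynomial (Fin m) ℤ :=
  alternant X * (g.partition.parts.map fun c => ∑ i, X i ^ c).prod

theorem coeff_mul_C_right {σ R : Type*} [CommSemiring R] (β : σ →₀ ℕ) (p : MvPolynomial σ R)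
    (a : R) : coeff β (p * C a) = coeff β p * a := by
  rw [mul_comm, coeff_C_mul, mul_comm]

theorem coeff_prod_X_pow {σ R : Type*} [Fintype σ] [DecidableEq σ] [CommSemiring R] (w : Perm σ)
    (N β : σ →₀ ℕ) [Decidable (∀ i, N i = β (w i))] :
    coeff β (∏ i, (X (w i) : MvPolynomial σ R) ^ N i) = if ∀ i, N i = β (w i) then 1 else 0 := by
  have h : ∏ i, (X (w i) : MvPolynomial σ R) ^ N i =
      monomial (Finsupp.equivFunOnFinite.symm fun i => N (w⁻¹ i)) 1 := by
    rw [monomial_eq, C_1, one_mul, Finsupp.prod_fintype _ _ (by simp)]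
    refine Eq.trans ?_ (Equiv.prod_comp w fun i => (X i : MvPolynomial σ R) ^ N (w⁻¹ i))
    simp
  rw [h, coeff_monomial]
  refine if_congr ?_ rfl rfl
  constructor
  · intro h i
    rw [← h]
    simp
  · intro h
    ext i
    simp [h]

/-- This is ⟨ψ, ψ⟩ = 1. Taking x^β y^β in the product of two copies of the generating polynomial,
the cycle index in the variables x_i y_j and the Cauchy identity leave a signed sum over w of
monomials matching x-exponents to y-exponents through w. As β has distinct entries, only w = 1
contributes. -/
theorem sum_coeff_frobeniusPoly_sq (β : Fin m →₀ ℕ) (hβ : Function.Injective β)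
    (hsum : ∑ i, β i = n + ∑ i : Fin m, #(Ioi i)) :
    ∑ g : Perm (Fin n), coeff β (frobeniusPoly m g) * coeff β (frobeniusPoly m g) =
      n.factorial := by
  -- Two sets of variables, realized as polynomials in x with coefficients in polynomials in y.
  let x : Fin m → MvPolynomial (Fin m) (MvPolynomial (Fin m) ℤ) := fun i => X i
  let y : Fin m → MvPolynomial (Fin m) (MvPolynomial (Fin m) ℤ) := fun i => C (X i)
  have h1 : ∀ g : Perm (Fin n), map C (frobeniusPoly m g) * C (frobeniusPoly m g) =
      alternant x * alternant y *
        (g.partition.parts.map fun c => ∑ p : Fin m × Fin m, (x p.1 * y p.2) ^ c).prod := by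
    intro g
    have h2 : map C (frobeniusPoly m g) =
        alternant x * (g.partition.parts.map fun c => ∑ i, x i ^ c).prod := by
      rw [frobeniusPoly, map_mul, map_alternant, map_multiset_prod, Multiset.map_map]
      simp [x]
    have h3 : (C (frobeniusPoly m g) : MvPolynomial (Fin m) (MvPolynomial (Fin m) ℤ)) =
        alternant y * (g.partition.parts.map fun c => ∑ i, y i ^ c).prod := by
      rw [frobeniusPoly, map_mul, map_alternant, map_multiset_prod, Multiset.map_map]
      simp [y]
    rw [h2, h3, mul_mul_mul_comm, ← Multiset.prod_map_mul]
    congr 2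
    refine Multiset.map_congr rfl fun c _ => ?_
    rw [sum_mul_sum, Fintype.sum_prod_type]
    simp_rw [mul_pow]
  have h4 : ∑ g : Perm (Fin n), map C (frobeniusPoly m g) * C (frobeniusPoly m g) =
      (n.factorial : MvPolynomial (Fin m) (MvPolynomial (Fin m) ℤ)) *
      ∑ w : Perm (Fin m), ((Equiv.Perm.sign w : ℤ) : MvPolynomial (Fin m) (MvPolynomial (Fin m) ℤ)) *
        ∑ N ∈ finsuppAntidiag univ (n + ∑ i : Fin m, #(Ioi i)), ∏ i, (x (w i) * y i) ^ N i := by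
    rw [sum_congr rfl fun g _ => h1 g, ← mul_sum, sum_prod_powerSum_partition,
      ← alternant_mul_alternant_mul_sum, mul_left_comm]
    congr!
  have h5 := congrArg (fun q => coeff β (coeff β q)) h4
  simp only [coeff_sum, coeff_mul_C_right, coeff_map, coeff_C_mul] at h5
  rw [h5, ← map_natCast (C : MvPolynomial (Fin m) ℤ →+* _), coeff_C_mul,
    ← map_natCast (C : ℤ →+* _), coeff_C_mul]
  have h6 : ∀ (w : Perm (Fin m)) (N : Fin m →₀ ℕ), coeff β (coeff β (∏ i, (x (w i) * y i) ^ N i)) =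
      if (∀ i, N i = β (w i)) ∧ N = β then 1 else 0 := by
    intro w N
    have h7 : ∏ i, (x (w i) * y i) ^ N i = (∏ i, X (w i) ^ N i) * C (∏ i, X i ^ N i) := by
      simp [x, y, mul_pow, prod_mul_distrib]
    rw [h7, coeff_mul_C_right, coeff_prod_X_pow]
    have h8 : coeff β (∏ i, (X i : MvPolynomial (Fin m) ℤ) ^ N i) = if N = β then 1 else 0 := by
      refine (coeff_prod_X_pow (R := ℤ) 1 N β).trans ?_
      split_ifs with h h' h'
      · rfl
      · exact absurd (Finsupp.ext h) h'
      · exact absurd (fun i => by rw [h']; rfl) h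
      · rfl
    by_cases hw : ∀ i, N i = β (w i)
    · rw [if_pos hw, one_mul, h8]
      exact if_congr (by rw [and_iff_right hw]) rfl rfl
    · simp [hw]
  rw [coeff_sum, coeff_sum, sum_eq_single 1]
  · rw [Equiv.Perm.sign_one, Units.val_one, Int.cast_one, one_mul, coeff_sum, coeff_sum,
      sum_eq_single β]
    · rw [h6]
      simp
    · intro N _ hN
      rw [h6, if_neg fun h => hN h.2]
    · intro h
      refine absurd (mem_finsuppAntidiag.2 ⟨hsum, by simp⟩) h
  · intro w _ hw
    rw [← map_intCast (C : MvPolynomial (Fin m) ℤ →+* _), coeff_C_mul,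
      ← map_intCast (C : ℤ →+* _), coeff_C_mul, coeff_sum, coeff_sum, sum_eq_zero, mul_zero]
    intro N _
    rw [h6, if_neg]
    rintro ⟨h, rfl⟩
    exact hw (Equiv.ext fun i => (hβ (h i)).symm)
  · simp

end norm

end Specht
end

/-! ### Permutation characters and Frobenius's character formula. -/

noncomputable section

namespace Specht

open Finset

section permutationCharacter

variable {G X : Type*} [Group G] [MulAction G X] [Fintype X] [DecidableEq X]

theorem character_ofMulAction (g : G) :
    (Representation.ofMulAction ℂ G X).character g = #{x : X | g • x = x} := by
  have h : Representation.ofMulAction ℂ G X g = ∑ x : X, dualTensorHom ℂ _ _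
      ((Finsupp.lapply x ∘ₗ (MonoidAlgebra.coeffLinearEquiv ℂ).toLinearMap) ⊗ₜ[ℂ]
        (MonoidAlgebra.single (g • x) (1 : ℂ))) := by
    refine LinearMap.ext fun v => ?_
    induction v using MonoidAlgebra.induction_linear with
    | zero => simp
    | add x y hx hy => rw [map_add, map_add, hx, hy]
    | single x a =>
      rw [Representation.ofMulAction_single, LinearMap.sum_apply, sum_eq_single x]
      · simp
      · intro y _ hy
        simp [hy.symm]
      · simp
  rw [Representation.character, h, map_sum, card_filter, Nat.cast_sum]
  refine sum_congr rfl fun x _ => ?_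
  rw [LinearMap.trace_eq_contract_apply]
  simp [Finsupp.single_apply]

end permutationCharacter

open scoped Classical

section labelling

variable {n m : ℕ}

theorem content_comp (f : Fin n → Fin m) (σ : Perm (Fin n)) : content (f ∘ σ) = content f := by
  refine Finsupp.ext fun i => ?_
  rw [content_apply, content_apply]
  refine card_bij (fun a _ => σ a) ?_ ?_ ?_
  · intro a ha
    simpa using ha
  · intro a _ b _ h
    exact σ.injective h
  · intro b hb
    exact ⟨σ⁻¹ b, by simpa using hb, by simp⟩

/-- The labellings with prescribed label counts `c`, where the counts are given by an equation
`c i + j.rev = β i` with `j = w i`. -/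
def Labelling (n : ℕ) {m : ℕ} (β : Fin m →₀ ℕ) (w : Perm (Fin m)) : Type :=
  {f : Fin n → Fin m // ∀ i, content f i + ((w i).rev : ℕ) = β i}

variable {β : Fin m →₀ ℕ} {w : Perm (Fin m)}

instance : Fintype (Labelling n β w) := inferInstanceAs (Fintype {_f : Fin n → Fin m // _})

instance : MulAction (Perm (Fin n)) (Labelling n β w) where
  smul σ f := ⟨f.1 ∘ (σ⁻¹ : Perm (Fin n)), by rw [content_comp]; exact f.2⟩
  one_smul _ := rfl
  mul_smul σ τ f := by
    refine Subtype.ext (funext fun a => ?_)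
    change f.1 ((σ * τ)⁻¹ a) = f.1 (τ⁻¹ (σ⁻¹ a))
    rw [mul_inv_rev, Equiv.Perm.mul_apply]

theorem Labelling.smul_apply (σ : Perm (Fin n)) (f : Labelling n β w) (a : Fin n) :
    (σ • f).1 a = f.1 (σ⁻¹ a) := rfl

theorem Labelling.smul_eq_iff (σ : Perm (Fin n)) (f : Labelling n β w) :
    σ • f = f ↔ f.1 ∘ σ = f.1 := by
  constructor
  · intro h
    funext a
    rw [Function.comp_apply]
    conv_lhs => rw [← h]
    rw [Labelling.smul_apply]
    simp
  · intro h
    refine Subtype.ext (funext fun a => ?_)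
    rw [Labelling.smul_apply, ← congrFun h]
    simp

/-- Expanding the alternant gives a determinantal formula for ψ in permutation characters. Stating
the counts by an addition makes the labelling set empty when a count would be negative, which is the
required convention. -/
theorem coeff_frobeniusPoly (β : Fin m →₀ ℕ) (g : Perm (Fin n)) :
    ((MvPolynomial.coeff β (frobeniusPoly m g) : ℤ) : ℂ) = ∑ w : Perm (Fin m),
      ((Equiv.Perm.sign w : ℤ) : ℂ) *
        (Representation.ofMulAction ℂ (Perm (Fin n)) (Labelling n β w)).character g := by
  have h1 : ∀ (w : Perm (Fin m)) (f : Fin n → Fin m), MvPolynomial.coeff β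
      ((∏ i, (MvPolynomial.X i : MvPolynomial (Fin m) ℤ) ^ ((w i).rev : ℕ)) *
        ∏ a, MvPolynomial.X (f a)) =
      if ∀ i, content f i + ((w i).rev : ℕ) = β i then 1 else 0 := by
    intro w f
    rw [prod_eq_prod_pow_content f, ← prod_mul_distrib]
    simp_rw [← pow_add]
    have h := coeff_prod_X_pow (R := ℤ) (1 : Perm (Fin m))
      (Finsupp.equivFunOnFinite.symm fun i => ((w i).rev : ℕ) + content f i) β
    refine h.trans (if_congr ?_ rfl rfl)
    refine forall_congr' fun i => ?_
    rw [add_comm (content f i)]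
    rfl
  rw [frobeniusPoly, alternant, ← Matrix.det_transpose, Matrix.det_apply',
    prod_powerSum_partition, sum_mul, MvPolynomial.coeff_sum, Int.cast_sum]
  refine sum_congr rfl fun w _ => ?_
  simp only [Matrix.transpose_apply, Matrix.of_apply]
  rw [mul_assoc, ← map_intCast (MvPolynomial.C : ℤ →+* _), MvPolynomial.coeff_C_mul, mul_sum,
    MvPolynomial.coeff_sum, sum_congr rfl fun f _ => h1 w f, character_ofMulAction, Int.cast_mul,
    Int.cast_id]
  congr 1
  rw [← sum_filter, sum_const, nsmul_eq_mul, mul_one, Int.cast_natCast, filter_filter]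
  congr 1
  symm
  refine card_bij (fun f _ => f.1) ?_ ?_ ?_
  · intro f hf
    rw [mem_filter]
    refine ⟨mem_univ _, ?_, f.2⟩
    rw [← Labelling.smul_eq_iff]
    exact (mem_filter.1 hf).2
  · intro f _ f' _ h
    exact Subtype.ext h
  · intro f hf
    rw [mem_filter] at hf
    obtain ⟨-, h2, h3⟩ := hf
    exact ⟨⟨f, h3⟩, mem_filter.2 ⟨mem_univ _, (Labelling.smul_eq_iff g ⟨f, h3⟩).2 h2⟩, rfl⟩

end labelling

section formula

variable {n m : ℕ} {μ : YoungDiagram}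

/-- The first `m` beta numbers of a Young diagram. -/
def betaNumbers (μ : YoungDiagram) (m : ℕ) : Fin m →₀ ℕ :=
  Finsupp.equivFunOnFinite.symm fun i => μ.rowLen i + (i.rev : ℕ)

theorem betaNumbers_apply (μ : YoungDiagram) (m : ℕ) (i : Fin m) :
    betaNumbers μ m i = μ.rowLen i + (i.rev : ℕ) := rfl

theorem betaNumbers_strictAnti (μ : YoungDiagram) (m : ℕ) : StrictAnti (betaNumbers μ m) := by
  intro i j h
  rw [betaNumbers_apply, betaNumbers_apply]
  have h1 := μ.rowLen_anti i j h.le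
  have h2 : j.rev < i.rev := Fin.rev_lt_rev.2 h
  have h3 : (j.rev : ℕ) < i.rev := h2
  omega

theorem Tableau.row_lt (t : Tableau n μ) (hm : μ.colLen 0 ≤ m) (a : Fin n) :
    Tableau.row t a < m :=
  (t.row_lt_colLen a).trans_le ((μ.colLen_anti 0 _ (Nat.zero_le _)).trans hm)

theorem sum_rowLen (t : Tableau n μ) (hm : μ.colLen 0 ≤ m) : ∑ i : Fin m, μ.rowLen i = n := by
  have h := card_eq_sum_card_fiberwise (s := univ) (t := univ)
    (f := fun a => (⟨Tableau.row t a, t.row_lt hm a⟩ : Fin m)) (fun _ _ => by simp)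
  rw [card_univ, Fintype.card_fin] at h
  rw [h]
  refine sum_congr rfl fun i _ => ?_
  rw [← Tableau.card_row t]
  congr 1
  ext a
  simp [Fin.ext_iff]

theorem sum_betaNumbers (t : Tableau n μ) (hm : μ.colLen 0 ≤ m) :
    ∑ i, betaNumbers μ m i = n + ∑ i : Fin m, #(Ioi i) := by
  simp_rw [betaNumbers_apply, sum_add_distrib, sum_rowLen t hm, Fin.card_Ioi, Fin.val_rev]
  congr 1
  refine sum_congr rfl fun i _ => ?_
  omega

/-- The rearrangement inequality, applied to the indicator of an initial segment. -/
theorem sum_val_le_sum_perm (w : Perm (Fin m)) (k : ℕ) :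
    ∑ i ∈ univ.filter (fun i : Fin m => (i : ℕ) < k), (i : ℕ) ≤ ∑ i ∈ univ.filter (fun i : Fin m => (i : ℕ) < k), (w i : ℕ) := by
  have hanti : Antivary (fun i : Fin m => if (i : ℕ) < k then 1 else 0) (fun i : Fin m => (i : ℕ)) := by
    intro i j hij
    change (if (j : ℕ) < k then 1 else 0) ≤ (if (i : ℕ) < k then 1 else 0)
    have hij' : (i : ℕ) < j := hij
    split_ifs <;> omega
  have h := hanti.sum_mul_le_sum_mul_comp_perm (σ := w)
  simpa [sum_filter] using h

/-- The counts c_i of a labelling satisfy c_i + i = μ_i + w(i), so their partial sums dominate those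
of μ. -/
theorem card_row_lt_le (t : Tableau n μ) (hm : μ.colLen 0 ≤ m) (w : Perm (Fin m))
    (x : Labelling n (betaNumbers μ m) w) (k : ℕ) :
    #{a | Tableau.row t a < k} ≤ #{a | (x.1 a : ℕ) < k} := by
  have hsum : ∀ f : Fin n → Fin m, #{a | (f a : ℕ) < k} =
      ∑ i ∈ univ.filter (fun i : Fin m => (i : ℕ) < k), content f i := by
    intro f
    rw [card_eq_sum_card_fiberwise (f := f) (t := univ.filter fun i : Fin m => (i : ℕ) < k)]
    · refine sum_congr rfl fun i hi => ?_
      rw [content_apply, filter_filter]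
      congr 1
      ext a
      simp only [mem_filter, mem_univ, true_and, and_iff_right_iff_imp]
      rintro rfl
      simpa using hi
    · intro a ha
      simpa using ha
  have h1 := hsum (fun a => ⟨Tableau.row t a, t.row_lt hm a⟩)
  have h2 : ∀ i : Fin m, content (fun a => (⟨Tableau.row t a, t.row_lt hm a⟩ : Fin m)) i =
      μ.rowLen i := by
    intro i
    rw [content_apply, ← Tableau.card_row t]
    congr 1
    ext a
    simp [Fin.ext_iff]
  simp_rw [h2] at h1
  rw [h1, hsum]
  have h3 := sum_val_le_sum_perm w k
  have h4 : ∑ i ∈ univ.filter (fun i : Fin m => (i : ℕ) < k), (content x.1 i + i) =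
      ∑ i ∈ univ.filter (fun i : Fin m => (i : ℕ) < k), (μ.rowLen i + w i) := by
    refine sum_congr rfl fun i _ => ?_
    have := x.2 i
    rw [betaNumbers_apply, Fin.val_rev, Fin.val_rev] at this
    omega
  rw [sum_add_distrib, sum_add_distrib] at h4
  omega

/-- A labelling that survives is column equivalent to the rows of t, hence has counts μ_i; comparing
with the counts prescribed by w forces w = 1. -/
theorem antisymmetrizer_labelling (t : Tableau n μ) (hm : μ.colLen 0 ≤ m) {w : Perm (Fin m)}
    (hw : w ≠ 1) : antisymmetrizer (Representation.ofMulAction ℂ (Perm (Fin n))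
      (Labelling n (betaNumbers μ m) w)) t = 0 := by
  refine LinearMap.ext fun v => ?_
  induction v using MonoidAlgebra.induction_linear with
  | zero => simp
  | add x y hx hy => rw [map_add, hx, hy]; simp
  | single x a =>
    have ha : MonoidAlgebra.single x a = a • MonoidAlgebra.single x (1 : ℂ) := by simp
    rw [ha, map_smul]
    rcases antisymmetrizer_single (fun (x : Labelling n (betaNumbers μ m) w) a => (x.1 a : ℕ))
      (fun x y h => Subtype.ext (funext fun a => Fin.ext (congrFun h a)))
      (fun g x i => rfl) t (card_row_lt_le t hm w) x with h | ⟨π, -, h⟩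
    · rw [h]
      simp
    · refine absurd (Equiv.ext fun i => ?_) hw
      have h1 : content (π⁻¹ • x).1 i = μ.rowLen i := by
        rw [content_apply, ← Tableau.card_row t, ← h]
        congr 1
        ext a
        simp [Fin.ext_iff]
      have h2 := (π⁻¹ • x).2 i
      rw [h1, betaNumbers_apply] at h2
      exact Fin.rev_injective (Fin.ext (Nat.add_left_cancel h2))

theorem character_labelling_one (hm : μ.colLen 0 ≤ m) (g : Perm (Fin n)) :
    (Representation.ofMulAction ℂ (Perm (Fin n)) (Labelling n (betaNumbers μ m) 1)).character g =
      (permRep n μ).character g := by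
  have := Fintype.ofFinite (Tabloid n μ)
  rw [character_ofMulAction, character_ofMulAction]
  congr 1
  have hzero : ∀ k, m ≤ k → μ.rowLen k = 0 := by
    intro k hk
    by_contra h
    have := YoungDiagram.mem_iff_lt_colLen.1 (YoungDiagram.mem_iff_lt_rowLen.2
      (Nat.pos_of_ne_zero h))
    omega
  have hc : ∀ x : Labelling n (betaNumbers μ m) 1, ∀ k, #{a | (x.1 a : ℕ) = k} = μ.rowLen k := by
    intro x k
    by_cases hk : k < m
    · have := x.2 ⟨k, hk⟩
      rw [betaNumbers_apply, Equiv.Perm.one_apply] at this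
      rw [← Nat.add_right_cancel this, content_apply]
      congr 1
      ext a
      simp [Fin.ext_iff]
    · rw [hzero k (not_lt.1 hk), card_eq_zero, filter_eq_empty_iff]
      intro a _ h
      exact hk (h ▸ (x.1 a).2)
  refine card_bij (fun x _ => ⟨fun a => (x.1 a : ℕ), fun k => by convert hc x k⟩) ?_ ?_ ?_
  · intro x hx
    refine mem_filter.2 ⟨mem_univ _, Tabloid.ext (funext fun a => ?_)⟩
    have h := (mem_filter.1 hx).2
    exact congrArg (fun y : Labelling n (betaNumbers μ m) 1 => (y.1 a : ℕ)) h
  · intro x _ y _ h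
    refine Subtype.ext (funext fun a => Fin.ext ?_)
    exact congrFun (congrArg Tabloid.row h) a
  · intro T hT
    have hlt : ∀ a, T.row a < m := by
      intro a
      by_contra h
      have h1 := T.card_row (T.row a)
      rw [hzero _ (not_lt.1 h), card_eq_zero, filter_eq_empty_iff] at h1
      exact h1 (mem_univ a) rfl
    refine ⟨⟨fun a => ⟨T.row a, hlt a⟩, fun i => ?_⟩, ?_, rfl⟩
    · rw [betaNumbers_apply, ← T.card_row, content_apply]
      congr 2
      ext a
      simp [Fin.ext_iff]
    · refine mem_filter.2 ⟨mem_univ _, Subtype.ext (funext fun a => Fin.ext ?_)⟩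
      exact congrFun (congrArg Tabloid.row (mem_filter.1 hT).2) a

/-- This is ⟨ψ, χ⟩ = 1: each w contributes the signed dimension of a Hom space out of V_μ, which is
0 for w ≠ 1 and 1 for the tabloid module. -/
theorem sum_coeff_frobeniusPoly_mul_character (t : Tableau n μ) (hm : μ.colLen 0 ≤ m) :
    ∑ g : Perm (Fin n), ((MvPolynomial.coeff (betaNumbers μ m) (frobeniusPoly m g) : ℤ) : ℂ) *
      (rep n μ).character g⁻¹ = n.factorial := by
  have hcard : (Nat.card (Perm (Fin n)) : ℂ) = n.factorial := by
    rw [Nat.card_eq_fintype_card, Fintype.card_perm, Fintype.card_fin]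
  have hne : (Nat.card (Perm (Fin n)) : ℂ) ≠ 0 := by
    rw [hcard]
    exact_mod_cast n.factorial_ne_zero
  have := invertibleOfNonzero hne
  simp_rw [coeff_frobeniusPoly, sum_mul]
  rw [sum_comm, sum_eq_single 1]
  · have h := Representation.card_inv_mul_sum_char_mul_char_eq_finrank (rep n μ) (permRep n μ)
    rw [finrank_intertwiningMap_permRep t, inv_mul_eq_iff_eq_mul₀ hne, hcard] at h
    simp_rw [character_labelling_one hm]
    simpa using h
  · intro w _ hw
    have h := Representation.card_inv_mul_sum_char_mul_char_eq_finrank (rep n μ)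
      (Representation.ofMulAction ℂ (Perm (Fin n)) (Labelling n (betaNumbers μ m) w))
    have hs : Subsingleton ((rep n μ).IntertwiningMap
        (Representation.ofMulAction ℂ (Perm (Fin n)) (Labelling n (betaNumbers μ m) w))) :=
      ⟨fun θ η => by
        rw [intertwiningMap_eq_zero t (antisymmetrizer_labelling t hm hw) θ,
          intertwiningMap_eq_zero t (antisymmetrizer_labelling t hm hw) η]⟩
    rw [Module.finrank_zero_of_subsingleton, inv_mul_eq_iff_eq_mul₀ hne, Nat.cast_zero,
      mul_zero] at h
    simp_rw [mul_assoc]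
    rw [← mul_sum, h, mul_zero]
  · simp

theorem sum_character_mul_character (t : Tableau n μ) :
    ∑ g : Perm (Fin n), (rep n μ).character g * (rep n μ).character g⁻¹ = n.factorial := by
  have hcard : (Nat.card (Perm (Fin n)) : ℂ) = n.factorial := by
    rw [Nat.card_eq_fintype_card, Fintype.card_perm, Fintype.card_fin]
  have hne : (Nat.card (Perm (Fin n)) : ℂ) ≠ 0 := by
    rw [hcard]
    exact_mod_cast n.factorial_ne_zero
  have := invertibleOfNonzero hne
  have hi := rep_isIrreducible t
  have h := Representation.card_inv_mul_sum_char_mul_char_eq_finrank (rep n μ) (rep n μ)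
  rw [Representation.IsIrreducible.finrank_intertwiningMap_self, inv_mul_eq_iff_eq_mul₀ hne,
    hcard] at h
  simpa using h

theorem character_inv {V : Type*} [AddCommGroup V] [Module ℂ V]
    (ρ : Representation ℂ (Perm (Fin n)) V) (g : Perm (Fin n)) :
    ρ.character g⁻¹ = ρ.character g := by
  have h : IsConj g g⁻¹ := by
    rw [Equiv.Perm.isConj_iff_cycleType_eq, Equiv.Perm.cycleType_inv]
  obtain ⟨c, hc⟩ := isConj_iff.1 h
  rw [← hc, Representation.char_conj]

/-- Frobenius's character formula for Specht modules. -/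
theorem character_eq_coeff (t : Tableau n μ) (hm : μ.colLen 0 ≤ m) (g : Perm (Fin n)) :
    (rep n μ).character g =
      ((MvPolynomial.coeff (betaNumbers μ m) (frobeniusPoly m g) : ℤ) : ℂ) := by
  have h1 := sum_coeff_frobeniusPoly_mul_character t hm
  have h2 := sum_character_mul_character t
  have h3 := sum_coeff_frobeniusPoly_sq (betaNumbers μ m) (betaNumbers_strictAnti μ m).injective
    (sum_betaNumbers t hm)
  simp_rw [character_inv] at h1 h2
  set χ := (rep n μ).character with hχ
  set ψ : Perm (Fin n) → ℤ := fun g =>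
    MvPolynomial.coeff (betaNumbers μ m) (frobeniusPoly m g) with hψ
  have h3' : ∑ g, (ψ g : ℂ) * ψ g = n.factorial := by exact_mod_cast congrArg (Int.cast : ℤ → ℂ) h3
  have hre : ∀ g, χ g = ((χ g).re : ℂ) := fun g =>
    (Complex.conj_eq_iff_re.1 (star_character t g)).symm
  -- The sum of squares is n! (1 - 2 + 1); reality of χ makes every term nonnegative.
  have h4 : ∑ g, (((χ g).re - ψ g) ^ 2 : ℝ) = 0 := by
    have h5 : ((∑ g, (((χ g).re - ψ g) ^ 2 : ℝ) : ℝ) : ℂ) = 0 := by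
      push_cast
      simp_rw [← hre]
      have h6 : ∀ g, (χ g - ψ g) ^ 2 = χ g * χ g - 2 * (ψ g * χ g) + ψ g * ψ g :=
        fun g => by ring
      simp_rw [h6, sum_add_distrib, sum_sub_distrib, ← mul_sum]
      rw [h1, h2, h3']
      ring
    exact_mod_cast h5
  rw [sum_eq_zero_iff_of_nonneg fun g _ => sq_nonneg _] at h4
  have h7 := h4 g (mem_univ g)
  rw [sq_eq_zero_iff, sub_eq_zero] at h7
  rw [hre, h7]
  simp [hψ]

end formula

end Specht
end

/-! ### Removing hooks from beta numbers: the Murnaghan–Nakayama recursion. -/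

noncomputable section

namespace Specht

open Finset

section alternating

open MvPolynomial

variable {m : ℕ}

/-- Frobenius's generating polynomial for the cycle type `s`. -/
def cycleTypePoly (m : ℕ) (s : Multiset ℕ) : MvPolynomial (Fin m) ℤ :=
  alternant X * (s.map fun c => ∑ i, X i ^ c).prod

/-- The coefficient of `cycleTypePoly m s` at the exponent vector `f`. -/
def cycleTypeCoeff (s : Multiset ℕ) (f : Fin m → ℕ) : ℤ :=
  coeff (Finsupp.equivFunOnFinite.symm f) (cycleTypePoly m s)

theorem rename_cycleTypePoly (s : Multiset ℕ) (σ : Perm (Fin m)) :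
    rename σ (cycleTypePoly m s) =
      ((Equiv.Perm.sign σ : ℤ) : MvPolynomial (Fin m) ℤ) * cycleTypePoly m s := by
  have h1 : rename σ (alternant X : MvPolynomial (Fin m) ℤ) =
      ((Equiv.Perm.sign σ : ℤ) : MvPolynomial (Fin m) ℤ) * alternant X := by
    have h := map_alternant (rename σ : MvPolynomial (Fin m) ℤ →ₐ[ℤ] _).toRingHom X
    refine h.trans ?_
    rw [alternant, alternant, ← Matrix.det_permute]
    congr 1
    ext i j : 2
    simp
  have h2 : rename σ ((s.map fun c => ∑ i, X i ^ c).prod : MvPolynomial (Fin m) ℤ) =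
      (s.map fun c => ∑ i, X i ^ c).prod := by
    rw [map_multiset_prod, Multiset.map_map]
    congr 1
    refine Multiset.map_congr rfl fun c _ => ?_
    simp only [Function.comp_apply, map_sum, map_pow, rename_X]
    exact Equiv.sum_comp σ fun i => (X i : MvPolynomial (Fin m) ℤ) ^ c
  rw [cycleTypePoly, map_mul, h1, h2, mul_assoc]

/-- The polynomial is alternating, so interchanging two equal exponents negates the coefficient
while fixing it. -/
theorem cycleTypeCoeff_eq_zero (s : Multiset ℕ) {f : Fin m → ℕ} {i j : Fin m} (hij : i ≠ j)
    (h : f i = f j) : cycleTypeCoeff s f = 0 := by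
  have h1 := congrArg (coeff (Finsupp.equivFunOnFinite.symm f))
    (rename_cycleTypePoly s (Equiv.swap i j))
  have h2 : Finsupp.mapDomain (Equiv.swap i j) (Finsupp.equivFunOnFinite.symm f) =
      Finsupp.equivFunOnFinite.symm f := by
    ext a
    rw [Finsupp.mapDomain_equiv_apply, Equiv.symm_swap]
    change f (Equiv.swap i j a) = f a
    rw [Equiv.swap_apply_def]
    split_ifs with h1 h2
    · rw [h1, h]
    · rw [h2, h]
    · rfl
  conv_lhs at h1 => rw [← h2]
  rw [coeff_rename_mapDomain _ (Equiv.injective _), Equiv.Perm.sign_swap hij] at h1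
  have h3 : cycleTypeCoeff s f = -cycleTypeCoeff s f := by simpa [cycleTypeCoeff] using h1
  omega

/-- The factor p_k lowers one beta number by k, that is, removes a rim hook of length k. Collisions
are not excluded here: their terms vanish by antisymmetry, and the signs arise only when the final
exponents are sorted. -/
theorem cycleTypeCoeff_cons (k : ℕ) (s : Multiset ℕ) (f : Fin m → ℕ) :
    cycleTypeCoeff (k ::ₘ s) f =
      ∑ i, if k ≤ f i then cycleTypeCoeff s (Function.update f i (f i - k)) else 0 := by
  have h : cycleTypePoly m (k ::ₘ s) = ∑ i, cycleTypePoly m s * X i ^ k := by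
    rw [cycleTypePoly, Multiset.map_cons, Multiset.prod_cons, cycleTypePoly, ← mul_sum]
    ring
  rw [cycleTypeCoeff, h, coeff_sum]
  refine sum_congr rfl fun i _ => ?_
  rw [X_pow_eq_monomial, coeff_mul_monomial', mul_one]
  refine if_congr (by simp [Finsupp.single_le_iff]) ?_ rfl
  rw [cycleTypeCoeff]
  congr 1
  ext a
  by_cases ha : a = i
  · subst ha
    simp
  · simp [ha]

/-- If no beta number can be lowered by `k`, the coefficients of types with a part `k` vanish. -/
theorem cycleTypeCoeff_cons_eq_zero {f : Fin m → ℕ} {k : ℕ} (hk : 0 < k) (s : Multiset ℕ)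
    (h : ∀ x ∈ univ.image f, k ≤ x → x - k ∈ univ.image f) : cycleTypeCoeff (k ::ₘ s) f = 0 := by
  rw [cycleTypeCoeff_cons]
  refine sum_eq_zero fun i _ => ?_
  split_ifs with hi
  · obtain ⟨j, -, hj⟩ := mem_image.1 (h (f i) (mem_image_of_mem f (mem_univ i)) hi)
    have hij : j ≠ i := by
      rintro rfl
      omega
    refine cycleTypeCoeff_eq_zero s hij.symm ?_
    rw [Function.update_self, Function.update_of_ne hij, hj]
  · rfl

/-- The value vanishes when every way of removing a k-hook leaves a beta set, x replaced by x - k,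
from which no l-hook can be removed. -/
theorem cycleTypeCoeff_cons_cons_eq_zero {f : Fin m → ℕ} (hf : Function.Injective f) {k l : ℕ}
    (hk : 0 < k) (hl : 0 < l) (s : Multiset ℕ)
    (h : ∀ x ∈ univ.image f, k ≤ x → x - k ∈ univ.image f ∨
      ∀ y ∈ insert (x - k) ((univ.image f).erase x), l ≤ y →
        y - l ∈ insert (x - k) ((univ.image f).erase x)) :
    cycleTypeCoeff (k ::ₘ l ::ₘ s) f = 0 := by
  rw [cycleTypeCoeff_cons]
  refine sum_eq_zero fun i _ => ?_
  split_ifs with hi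
  · rcases h (f i) (mem_image_of_mem f (mem_univ i)) hi with h1 | h1
    · obtain ⟨j, -, hj⟩ := mem_image.1 h1
      have hij : j ≠ i := by
        rintro rfl
        omega
      refine cycleTypeCoeff_eq_zero _ hij.symm ?_
      rw [Function.update_self, Function.update_of_ne hij, hj]
    · refine cycleTypeCoeff_cons_eq_zero hl s ?_
      have himage : univ.image (Function.update f i (f i - k)) =
          insert (f i - k) ((univ.image f).erase (f i)) := by
        ext x
        simp only [mem_image, mem_univ, true_and, mem_insert, mem_erase]
        constructor
        · rintro ⟨a, rfl⟩
          by_cases ha : a = i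
          · left
            rw [ha, Function.update_self]
          · right
            rw [Function.update_of_ne ha]
            exact ⟨fun h => ha (hf h), a, rfl⟩
        · rintro (rfl | ⟨hx, a, rfl⟩)
          · exact ⟨i, by rw [Function.update_self]⟩
          · exact ⟨a, Function.update_of_ne (fun h => hx (by rw [h])) _ _⟩
      rwa [himage]
  · rfl

/-- Only the alternant is left: its monomials have exponent vectors that rearrange 0, ..., m-1, with
the sign of the rearrangement as coefficient. -/
theorem cycleTypeCoeff_zero {f : Fin m → ℕ} (hf : Function.Injective f) :
    cycleTypeCoeff 0 f = if ∀ i, f i < m then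
      ∏ i, ∏ j ∈ Ioi i, (if f j < f i then 1 else -1) else 0 := by
  have h1 : ∀ w : Perm (Fin m), coeff (Finsupp.equivFunOnFinite.symm f)
      (∏ i, (X i : MvPolynomial (Fin m) ℤ) ^ ((w i).rev : ℕ)) =
        if ∀ i, ((w i).rev : ℕ) = f i then 1 else 0 := by
    intro w
    exact coeff_prod_X_pow (R := ℤ) (1 : Perm (Fin m))
      (Finsupp.equivFunOnFinite.symm fun i => ((w i).rev : ℕ)) (Finsupp.equivFunOnFinite.symm f)
  rw [cycleTypeCoeff, cycleTypePoly, Multiset.map_zero, Multiset.prod_zero, mul_one, alternant,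
    ← Matrix.det_transpose, Matrix.det_apply', coeff_sum]
  simp only [Matrix.transpose_apply, Matrix.of_apply]
  split_ifs with hlt
  · let g : Fin m → Fin m := fun i => (⟨f i, hlt i⟩ : Fin m).rev
    have hg : Function.Injective g := fun i j h => hf (congrArg Fin.val (Fin.rev_injective h))
    let w : Perm (Fin m) := Equiv.ofBijective g (Finite.injective_iff_bijective.1 hg)
    have hw : ∀ i, ((w i).rev : ℕ) = f i := by
      intro i
      change (((⟨f i, hlt i⟩ : Fin m).rev.rev : Fin m) : ℕ) = f i
      rw [Fin.rev_rev]
    rw [sum_eq_single w]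
    · rw [← map_intCast (C : ℤ →+* _), coeff_C_mul, h1, if_pos hw, mul_one,
        Equiv.Perm.sign_eq_prod_prod_Ioi]
      simp only [Units.coe_prod, Int.cast_id]
      refine prod_congr rfl fun i _ => prod_congr rfl fun j _ => ?_
      have h2 : w i < w j ↔ f j < f i := by
        rw [← hw, ← hw, ← Fin.rev_lt_rev]
        rfl
      by_cases h : f j < f i
      · rw [if_pos h, if_pos (h2.2 h)]
        rfl
      · rw [if_neg h, if_neg (mt h2.1 h)]
        rfl
    · intro v _ hv
      rw [← map_intCast (C : ℤ →+* _), coeff_C_mul, h1, if_neg, mul_zero]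
      intro h
      refine hv (Equiv.ext fun i => Fin.rev_injective (Fin.ext ?_))
      rw [h, hw]
    · simp
  · refine sum_eq_zero fun v _ => ?_
    rw [← map_intCast (C : ℤ →+* _), coeff_C_mul, h1, if_neg, mul_zero]
    intro h
    exact hlt fun i => h i ▸ (v i).rev.2

end alternating

/-! ### A computable form of the character values. -/

section evaluation

/-- The sign of the permutation that sorts a list into decreasing order. -/
def listSign : List ℕ → ℤ
  | [] => 1
  | x :: b => (b.map fun y => if y < x then 1 else -1).prod * listSign b

/-- Evaluation of the coefficients of `cycleTypePoly` by removing rim hooks. -/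
def evalCoeff : List ℕ → List ℕ → ℤ
  | [], b => if b.Nodup then (if ∀ x ∈ b, x < b.length then listSign b else 0) else 0
  | k :: s, b => if b.Nodup then ((List.range b.length).map fun i =>
      if k ≤ b.getD i 0 then evalCoeff s (b.set i (b.getD i 0 - k)) else 0).sum else 0

theorem listSign_ofFn {m : ℕ} (f : Fin m → ℕ) :
    listSign (List.ofFn f) = ∏ i, ∏ j ∈ Ioi i, (if f j < f i then 1 else -1) := by
  induction m with
  | zero => simp [listSign]
  | succ m ih =>
    rw [List.ofFn_succ, listSign, ih, Fin.prod_univ_succ, Fin.prod_Ioi_zero, List.map_ofFn,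
      List.prod_ofFn]
    simp only [Fin.prod_Ioi_succ, Function.comp_apply]

theorem set_ofFn {m : ℕ} (f : Fin m → ℕ) (i : Fin m) (v : ℕ) :
    (List.ofFn f).set i v = List.ofFn (Function.update f i v) := by
  refine List.ext_getElem (by simp) fun k h1 h2 => ?_
  rw [List.getElem_set, List.getElem_ofFn, List.getElem_ofFn, Function.update_apply]
  refine if_congr ?_ rfl rfl
  rw [Fin.ext_iff]
  exact eq_comm

/-- Lists turn the coefficients into something decidable by evaluation. Cutting off lists with
duplicates is harmless because the coefficients there are zero. -/
theorem evalCoeff_ofFn {m : ℕ} (s : List ℕ) (f : Fin m → ℕ) :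
    evalCoeff s (List.ofFn f) = cycleTypeCoeff (s : Multiset ℕ) f := by
  by_cases hf : Function.Injective f
  · induction s generalizing f with
    | nil =>
      rw [evalCoeff, if_pos (List.nodup_ofFn.2 hf), listSign_ofFn, Multiset.coe_nil,
        cycleTypeCoeff_zero hf]
      refine if_congr ?_ rfl rfl
      simp [List.mem_ofFn]
    | cons k s ih =>
      rw [evalCoeff, if_pos (List.nodup_ofFn.2 hf), ← Multiset.cons_coe, cycleTypeCoeff_cons,
        List.length_ofFn]
      refine Eq.trans (b := ∑ i ∈ range m, _) rfl ?_
      rw [Finset.sum_range]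
      refine sum_congr rfl fun i _ => ?_
      have h1 : (List.ofFn f).getD i 0 = f i := by simp
      rw [h1, set_ofFn]
      refine if_congr Iff.rfl ?_ rfl
      by_cases h2 : Function.Injective (Function.update f i (f i - k))
      · exact ih _ h2
      · have h3 : evalCoeff s (List.ofFn (Function.update f i (f i - k))) = 0 := by
          cases s <;> rw [evalCoeff, if_neg (mt List.nodup_ofFn.1 h2)]
        obtain ⟨a, b, hab, hne⟩ : ∃ a b, Function.update f i (f i - k) a =
            Function.update f i (f i - k) b ∧ a ≠ b := by
          simpa [Function.Injective] using h2
        rw [h3, cycleTypeCoeff_eq_zero _ hne hab]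
  · have h3 : evalCoeff s (List.ofFn f) = 0 := by
      cases s <;> rw [evalCoeff, if_neg (mt List.nodup_ofFn.1 hf)]
    obtain ⟨a, b, hab, hne⟩ : ∃ a b, f a = f b ∧ a ≠ b := by
      simpa [Function.Injective] using hf
    rw [h3, cycleTypeCoeff_eq_zero _ hne hab]

/-- The weakly decreasing lists of positive integers that are at most `b` and not divisible by `p`,
with sum `n` and at most `d` entries. -/
def regularTypes (p : ℕ) : ℕ → ℕ → ℕ → List (List ℕ)
  | 0, n, _ => if n = 0 then [[]] else []
  | d + 1, n, b => if n = 0 then [[]] else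
      (List.range (min n b)).flatMap fun k => if p ∣ k + 1 then [] else
        (regularTypes p d (n - (k + 1)) (k + 1)).map ((k + 1) :: ·)

/-- The parameter d is recursion fuel. Completeness of the enumeration is all that a check over
every regular type requires. -/
theorem mem_regularTypes {p d n b : ℕ} {l : List ℕ} (hd : l.length ≤ d) (hsum : l.sum = n)
    (hl : l.Pairwise (· ≥ ·)) (hb : ∀ c ∈ l, c ≤ b) (hpos : ∀ c ∈ l, 0 < c)
    (hp : ∀ c ∈ l, ¬ p ∣ c) : l ∈ regularTypes p d n b := by
  induction l generalizing d n b with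
  | nil =>
    subst hsum
    cases d <;> simp [regularTypes]
  | cons c l ih =>
    obtain ⟨d, rfl⟩ : ∃ e, d = e + 1 := ⟨d - 1, by simp at hd; omega⟩
    have hc : 0 < c := hpos c (by simp)
    have hcb : c ≤ b := hb c (by simp)
    rw [List.sum_cons] at hsum
    rw [regularTypes, if_neg (by omega), List.mem_flatMap]
    refine ⟨c - 1, ?_, ?_⟩
    · rw [List.mem_range]
      omega
    · rw [Nat.sub_add_cancel hc, if_neg (hp c (by simp)), List.mem_map]
      rw [List.pairwise_cons] at hl
      refine ⟨l, ih ?_ ?_ hl.2 (fun x hx => hl.1 x hx) (fun x hx => hpos x (by simp [hx]))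
        (fun x hx => hp x (by simp [hx])), rfl⟩
      · simpa using hd
      · omega

end evaluation

end Specht
end

/-! ### Beta sets with a hook of length n or n - 1. -/

noncomputable section

namespace Specht

open Finset

section betaSet

/-- Elements of S outside the initial segment are at least m and the missing ones at most m - 1, so
each replacement raises the sum by at least 1; d bounds the number of replacements. -/
theorem sum_sdiff_range {m d : ℕ} (S : Finset ℕ) (hcard : #S = m)
    (hsum : ∑ x ∈ S, x = ∑ x ∈ range m, x + d) :
    #(S \ range m) = #(range m \ S) ∧
      ∑ x ∈ S \ range m, x = ∑ x ∈ range m \ S, x + d ∧ #(S \ range m) ≤ d := by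
  have h1 : #(S \ range m) = #(range m \ S) := card_sdiff_comm (by rw [hcard, card_range])
  have h2 : ∑ x ∈ S \ range m, x = ∑ x ∈ range m \ S, x + d := by
    have ha := sum_sdiff (f := fun x : ℕ => x) (inter_subset_left (s₁ := S) (s₂ := range m))
    have hb := sum_sdiff (f := fun x : ℕ => x) (inter_subset_right (s₁ := S) (s₂ := range m))
    rw [sdiff_inter_self_left] at ha
    rw [sdiff_inter_self_right] at hb
    omega
  refine ⟨h1, h2, ?_⟩
  have h3 := card_nsmul_le_sum (S \ range m) (fun x => x) m fun x hx => by
    simpa using (mem_sdiff.1 hx).2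
  have h4 := sum_le_card_nsmul (range m \ S) (fun x => x + 1) m fun x hx => by
    have := mem_range.1 (mem_sdiff.1 hx).1
    omega
  rw [sum_add_distrib, sum_const, smul_eq_mul, mul_one, ← h1] at h4
  omega

theorem eq_range_of_sum_eq {m : ℕ} {S : Finset ℕ} (hcard : #S = m)
    (hsum : ∑ x ∈ S, x = ∑ x ∈ range m, x) : S = range m := by
  obtain ⟨-, -, h⟩ := sum_sdiff_range (d := 0) S hcard (by rw [hsum, add_zero])
  rw [Nat.le_zero, card_eq_zero, sdiff_eq_empty_iff_subset] at h
  exact eq_of_subset_of_card_le h (by rw [hcard, card_range])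

/-- With excess 1 exactly one replacement occurs, and it must be m - 1 by m: the beta set of the
one-cell partition. -/
theorem mem_iff_of_sum_eq_add_one {m : ℕ} {S : Finset ℕ} (hcard : #S = m)
    (hsum : ∑ x ∈ S, x = ∑ x ∈ range m, x + 1) (x : ℕ) : x ∈ S ↔ x = m ∨ x + 1 < m := by
  obtain ⟨h1, h2, h3⟩ := sum_sdiff_range S hcard hsum
  have h4 : #(S \ range m) ≠ 0 := by
    intro h
    rw [h, eq_comm, card_eq_zero] at h1
    rw [card_eq_zero] at h
    rw [h, h1] at h2
    simp at h2
  obtain ⟨a, ha⟩ := card_eq_one.1 (by omega : #(S \ range m) = 1)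
  obtain ⟨b, hb⟩ := card_eq_one.1 (by omega : #(range m \ S) = 1)
  rw [ha, hb, sum_singleton, sum_singleton] at h2
  have ha' : a ∈ S \ range m := by simp [ha]
  have hb' : b ∈ range m \ S := by simp [hb]
  rw [mem_sdiff, mem_range] at ha' hb'
  have hx : x ∈ S \ range m ↔ x = a := by rw [ha, mem_singleton]
  have hx' : x ∈ range m \ S ↔ x = b := by rw [hb, mem_singleton]
  rw [mem_sdiff, mem_range] at hx hx'
  by_cases h : x ∈ S
  · simp only [h, true_and, not_true, and_false, false_iff, true_iff] at *
    omega
  · simp only [h, false_and, not_false_eq_true, and_true, false_iff] at *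
    omega

theorem sum_insert_erase {X : Finset ℕ} {x k : ℕ} (hx : x ∈ X) (hkx : k ≤ x) (hk : x - k ∉ X) :
    #(insert (x - k) (X.erase x)) = #X ∧
      ∑ y ∈ insert (x - k) (X.erase x), y + k = ∑ y ∈ X, y := by
  have h : x - k ∉ X.erase x := fun h => hk (mem_of_mem_erase h)
  have h1 := sum_erase_add X (fun y => y) hx
  refine ⟨?_, ?_⟩
  · rw [card_insert_of_notMem h, card_erase_of_mem hx]
    have := card_pos.2 ⟨x, hx⟩
    omega
  · rw [sum_insert h]
    omega

/-- A beta set with a hook of length `n` is that of a hook. -/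
theorem mem_iff_of_hook {n : ℕ} {X : Finset ℕ} (h0 : 0 ∉ X) (hX : X.Nonempty)
    (hsum : ∑ y ∈ X, y = n + ∑ y ∈ range #X, y) (h : ∃ x ∈ X, n ≤ x ∧ x - n ∉ X) (y : ℕ) :
    y ∈ X ↔ y = n ∨ (1 ≤ y ∧ y < #X) := by
  obtain ⟨x, hx, hnx, hxn⟩ := h
  obtain ⟨h1, h2⟩ := sum_insert_erase hx hnx hxn
  have h3 := eq_range_of_sum_eq h1 (by omega)
  have hmem : ∀ z, z ∈ insert (x - n) (X.erase x) ↔ z < #X := fun z => by rw [h3, mem_range]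
  simp only [mem_insert, mem_erase] at hmem
  have hm : 0 < #X := card_pos.2 hX
  -- Removing the hook leaves the beta set of the empty partition, which contains 0. As X itself
  -- omits 0, the new element x - n must be 0.
  have hxn0 : x = n := by
    rcases (hmem 0).2 hm with h | h
    · omega
    · exact absurd h.2 h0
  subst hxn0
  have h5 := hmem y
  by_cases hy : y = x
  · subst hy
    simp [hx]
  · by_cases hy0 : y = 0
    · subst hy0
      simp [h0]
      omega
    · constructor
      · intro h
        right
        exact ⟨by omega, h5.1 (Or.inr ⟨hy, h⟩)⟩
      · rintro (h | h)
        · exact absurd h hy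
        · rcases h5.2 h.2 with h | h
          · omega
          · exact h.2

/-- A beta set with a hook of length `n - 1`. -/
theorem mem_iff_of_almost_hook {n : ℕ} {X : Finset ℕ} (h0 : 0 ∉ X) (hn : 1 ≤ n) (hX : 2 ≤ #X)
    (hsum : ∑ y ∈ X, y = n + ∑ y ∈ range #X, y)
    (h : ∃ x ∈ X, n - 1 ≤ x ∧ x - (n - 1) ∉ X) (y : ℕ) :
    y ∈ X ↔ y = n - 1 ∨ y = #X ∨ (1 ≤ y ∧ y + 1 < #X) := by
  obtain ⟨x, hx, hnx, hxn⟩ := h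
  obtain ⟨h1, h2⟩ := sum_insert_erase hx hnx hxn
  have hmem := mem_iff_of_sum_eq_add_one h1 (by omega)
  simp only [mem_insert, mem_erase] at hmem
  -- The remaining beta set is that of one cell; with at least two elements it contains 0, which can
  -- only be the lowered element.
  have hxn0 : x = n - 1 := by
    rcases (hmem 0).2 (by omega) with h | h
    · omega
    · exact absurd h.2 h0
  subst hxn0
  have h5 := hmem y
  by_cases hy : y = n - 1
  · subst hy
    simp [hx]
  · by_cases hy0 : y = 0
    · subst hy0
      simp [h0]
      omega
    · constructor
      · intro h
        right
        have := h5.1 (Or.inr ⟨hy, h⟩)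
        omega
      · rintro (h | h)
        · exact absurd h hy
        · rcases h5.2 (by omega) with h | h
          · omega
          · exact h.2

end betaSet

/-! ### Arithmetic of the hook lengths. -/

section classification

variable {n m p : ℕ} {P : ℕ → Prop}

/-- Here P is the beta set of (n-m+1, 1^(m-1)). Its hook lengths are n, 1, ..., n-m and 1, ..., m-1,
so p divides everything strictly between max(m-1, n-m) and n. Unless m is 2 or n-1, this includes
the consecutive numbers n-1 and n-2. -/
theorem classify_hook (hp : p.Prime) (hn : 3 ≤ n) (hm : 2 ≤ m) (hmn : m + 1 ≤ n)
    (hP : ∀ x, P x ↔ x = n ∨ (1 ≤ x ∧ x < m))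
    (h1 : ∀ k, 2 ≤ k → k ≤ n → ¬ p ∣ k → ∃ x, P x ∧ k ≤ x ∧ ¬ P (x - k))
    (h2 : ∀ k l, 2 ≤ k → 2 ≤ l → k + l ≤ n → ¬ p ∣ k → ¬ p ∣ l →
      ∃ x, P x ∧ k ≤ x ∧ ¬ P (x - k) ∧ ∃ y, (y = x - k ∨ (y ≠ x ∧ P y)) ∧ l ≤ y ∧
        ¬ (y - l = x - k ∨ (y - l ≠ x ∧ P (y - l)))) :
    (n = 3 ∧ m = 2 ∧ p = 2) ∨ (n = 4 ∧ m = 2 ∧ p = 3) ∨ (n = 4 ∧ m = 3 ∧ p = 3) ∨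
      (n = 5 ∧ m = 2 ∧ p = 2) ∨ (n = 5 ∧ m = 4 ∧ p = 2) := by
  simp only [hP] at h1 h2
  have hk : ∀ k, 2 ≤ k → m ≤ k → n - m < k → k < n → p ∣ k := by
    intro k h2k hmk hnk hkn
    by_contra hpk
    obtain ⟨x, hx⟩ := h1 k h2k hkn.le hpk
    omega
  have hm' : m = 2 ∨ m = n - 1 := by
    by_contra h
    have ha := hk (n - 1) (by omega) (by omega) (by omega) (by omega)
    have hb := hk (n - 2) (by omega) (by omega) (by omega) (by omega)
    have hc := Nat.dvd_sub ha hb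
    rw [show n - 1 - (n - 2) = 1 by omega] at hc
    exact hp.one_lt.ne' (Nat.dvd_one.1 hc)
  have hpn : p ∣ n - 1 := hk (n - 1) (by omega) (by omega) (by omega) (by omega)
  -- Removing an a-hook from (n-1, 1) or its conjugate leaves (b, 1) or its conjugate, which has no
  -- hook of length b.
  have hab : ∀ a b, 2 ≤ a → 2 ≤ b → a + b = n - 1 → ¬ p ∣ a → ¬ p ∣ b → False := by
    intro a b ha hb hab hpa hpb
    obtain ⟨x, hx1, hx2, hx3, y, hy⟩ := h2 a b ha hb (by omega) hpa hpb
    omega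
  rcases hp.eq_two_or_odd with rfl | hodd
  · have hn5 : n ≤ 6 := by
      by_contra h
      exact hab 3 (n - 4) (by omega) (by omega) (by omega) (by omega) (by omega)
    omega
  · have hp2 : p ≠ 2 := by rintro rfl; omega
    have hp2' : ¬ p ∣ 2 := fun h => hp2 ((Nat.prime_dvd_prime_iff_eq hp Nat.prime_two).1 h)
    have hn4 : n ≤ 4 := by
      by_contra h
      refine hab 2 (n - 3) (by omega) (by omega) (by omega) hp2' fun h3 => hp2' ?_
      have := Nat.dvd_sub hpn h3
      rwa [show n - 1 - (n - 3) = 2 by omega] at this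
    have hn4' : n = 3 ∨ n = 4 := by omega
    rcases hn4' with rfl | rfl
    · exact absurd hpn hp2'
    · have := (Nat.prime_dvd_prime_iff_eq hp Nat.prime_three).1 hpn
      omega

set_option maxHeartbeats 1000000 in
-- Here P is the beta set of (n-m, 2, 1^(m-2)). Its hook lengths above max(m, n-m) reduce to n-1, so
-- p divides every k strictly between. As p divides n, k = n-2 and k = n-3 would give p ∣ 2 and p ∣
-- 3; so m is within 3 of 0 or n.
theorem classify_almost_hook (hp : p.Prime) (hm : 2 ≤ m) (hmn : m + 2 ≤ n) (hpn : p ∣ n)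
    (hP : ∀ x, P x ↔ x = n - 1 ∨ x = m ∨ (1 ≤ x ∧ x + 1 < m))
    (h1 : ∀ k, 2 ≤ k → k ≤ n → ¬ p ∣ k → ∃ x, P x ∧ k ≤ x ∧ ¬ P (x - k))
    (h2 : ∀ k l, 2 ≤ k → 2 ≤ l → k + l ≤ n → ¬ p ∣ k → ¬ p ∣ l →
      ∃ x, P x ∧ k ≤ x ∧ ¬ P (x - k) ∧ ∃ y, (y = x - k ∨ (y ≠ x ∧ P y)) ∧ l ≤ y ∧
        ¬ (y - l = x - k ∨ (y - l ≠ x ∧ P (y - l)))) :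
    (n = 4 ∧ m = 2 ∧ p = 2) ∨ (n = 5 ∧ m = 2 ∧ p = 5) ∨ (n = 5 ∧ m = 3 ∧ p = 5) ∨
      (n = 6 ∧ m = 3 ∧ p = 2) ∨ (n = 6 ∧ m = 2 ∧ p = 3) ∨ (n = 6 ∧ m = 4 ∧ p = 3) ∨
      (n = 8 ∧ m = 3 ∧ p = 2) ∨ (n = 8 ∧ m = 5 ∧ p = 2) := by
  simp only [hP] at h1 h2
  have hsub : ∀ j, 1 ≤ j → j ≤ n → p ∣ n - j → p ∣ j := by
    intro j _ hj h
    have := Nat.dvd_sub hpn h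
    rwa [Nat.sub_sub_self hj] at this
  have hk : ∀ k, 2 ≤ k → m < k → n - m < k → k < n - 1 → p ∣ k := by
    intro k h2k hmk hnk hkn
    by_contra hpk
    obtain ⟨x, hx⟩ := h1 k h2k (by omega) hpk
    omega
  have hm' : m = 2 ∨ m = 3 ∨ m = n - 2 ∨ m = n - 3 := by
    by_contra h
    have ha := hsub 2 (by omega) (by omega) (hk (n - 2) (by omega) (by omega) (by omega) (by omega))
    have hb := hsub 3 (by omega) (by omega) (hk (n - 3) (by omega) (by omega) (by omega) (by omega))
    exact hp.one_lt.ne' (Nat.dvd_one.1 (Nat.dvd_sub hb ha))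
  by_cases hn4 : n = 4
  · subst hn4
    have := (Nat.prime_dvd_prime_iff_eq hp Nat.prime_two).1
      (hp.dvd_of_dvd_pow (show p ∣ 2 ^ 2 from hpn))
    omega
  by_cases hn5 : n = 5
  · subst hn5
    have := (Nat.prime_dvd_prime_iff_eq hp Nat.prime_five).1 hpn
    omega
  have hm'' : (m = 2 ∨ m = n - 2) ∨ (m = 3 ∨ m = n - 3) := by omega
  rcases hm'' with hm2 | hm3
  · have hp3 : p = 3 := by
      refine (Nat.prime_dvd_prime_iff_eq hp Nat.prime_three).1
        (hsub 3 (by omega) (by omega) ?_)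
      by_contra hpk
      obtain ⟨x, hx⟩ := h1 (n - 3) (by omega) (by omega) hpk
      omega
    subst hp3
    have hn8 : n ≤ 8 := by
      by_contra h
      -- The only removable (n-4)-hook leaves (2, 2), which has no hook of length 4.
      obtain ⟨x, hx1, hx2, hx3, y, hy⟩ := h2 (n - 4) 4 (by omega) (by omega) (by omega)
        (by omega) (by omega)
      rcases hm2 with hm2 | hm2
      · have hx : x = n - 1 := by omega
        clear hx1 hx2 hx3 h1 h2
        omega
      · have hx : x = n - 4 := by omega
        clear hx1 hx2 hx3 h1 h2
        omega
    omega
  · have hp2 : p = 2 := (Nat.prime_dvd_prime_iff_eq hp Nat.prime_two).1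
      (hsub 2 (by omega) (by omega) (hk (n - 2) (by omega) (by omega) (by omega) (by omega)))
    subst hp2
    have hn9 : n ≤ 9 := by
      by_contra h
      -- The only removable (n-5)-hook leaves (2, 2, 1) or (3, 2), neither of which is a hook of
      -- length 5.
      obtain ⟨x, hx1, hx2, hx3, y, hy⟩ := h2 (n - 5) 5 (by omega) (by omega) (by omega)
        (by omega) (by omega)
      rcases hm3 with hm3 | hm3
      · have hx : x = n - 1 := by omega
        clear hx1 hx2 hx3 h1 h2
        omega
      · have hx : x = n - 5 := by omega
        clear hx1 hx2 hx3 h1 h2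
        omega
    omega

end classification

end Specht
end

/-! ### From partitions and `p`-regular permutations to beta sets and cycle types. -/

noncomputable section

namespace Specht

open Finset

section partition

variable {n : ℕ}

/-- The beta numbers of a weakly decreasing list. -/
def betaList (l : List ℕ) : List ℕ := List.ofFn fun i : Fin l.length => l[i] + (i.rev : ℕ)

theorem betaNumbers_ofRowLens {l : List ℕ} (hl : l.SortedGE) (i : Fin l.length) :
    betaNumbers (YoungDiagram.ofRowLens l hl) l.length i = l[i] + (i.rev : ℕ) := by
  rw [betaNumbers_apply, YoungDiagram.rowLen_ofRowLens]

theorem colLen_ofRowLens {l : List ℕ} (hl : l.SortedGE) (hpos : ∀ x ∈ l, 0 < x) :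
    (YoungDiagram.ofRowLens l hl).colLen 0 = l.length := by
  rw [← YoungDiagram.length_rowLens, YoungDiagram.rowLens_length_ofRowLens hpos]

theorem card_cells_ofRowLens {l : List ℕ} (hl : l.SortedGE) (hpos : ∀ x ∈ l, 0 < x) :
    #(YoungDiagram.ofRowLens l hl).cells = l.sum := by
  set μ := YoungDiagram.ofRowLens l hl with hμ
  have h : #μ.cells = ∑ i ∈ range l.length, #{c ∈ μ.cells | c.1 = i} := by
    refine card_eq_sum_card_fiberwise fun c hc => ?_
    have h1 : (c.1, c.2) ∈ μ := hc
    have h2 := μ.up_left_mem le_rfl (Nat.zero_le c.2) h1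
    rw [YoungDiagram.mem_iff_lt_colLen, colLen_ofRowLens hl hpos] at h2
    simpa using h2
  rw [h, Finset.sum_range, ← Fin.sum_univ_getElem]
  refine sum_congr rfl fun i _ => ?_
  exact (YoungDiagram.rowLen_eq_card μ).symm.trans (YoungDiagram.rowLen_ofRowLens i)

theorem nonempty_tableau {l : List ℕ} (hl : l.SortedGE) (hpos : ∀ x ∈ l, 0 < x)
    (hsum : l.sum = n) : Nonempty (Tableau n (YoungDiagram.ofRowLens l hl)) := by
  rw [← Fintype.card_eq, Fintype.card_fin, Fintype.card_coe, card_cells_ofRowLens hl hpos, hsum]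

theorem character_ofRowLens {l : List ℕ} (hl : l.SortedGE) (hpos : ∀ x ∈ l, 0 < x)
    (hsum : l.sum = n) (g : Perm (Fin n)) :
    (rep n (YoungDiagram.ofRowLens l hl)).character g =
      (cycleTypeCoeff g.partition.parts fun i : Fin l.length => l[i] + (i.rev : ℕ) : ℤ) := by
  obtain ⟨t⟩ := nonempty_tableau hl hpos hsum
  rw [character_eq_coeff t (colLen_ofRowLens hl hpos).le]
  congr 2
  ext i
  exact betaNumbers_ofRowLens hl i

theorem strictAnti_beta {l : List ℕ} (hl : l.SortedGE) :
    StrictAnti fun i : Fin l.length => l[i] + (i.rev : ℕ) := by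
  have h := betaNumbers_strictAnti (YoungDiagram.ofRowLens l hl) l.length
  intro i j hij
  have := h hij
  rwa [betaNumbers_ofRowLens, betaNumbers_ofRowLens] at this

theorem pairwise_betaList {l : List ℕ} (hl : l.SortedGE) : (betaList l).Pairwise (· > ·) := by
  rw [betaList, List.pairwise_ofFn]
  exact fun i j hij => strictAnti_beta hl hij

theorem toFinset_betaList (l : List ℕ) :
    (betaList l).toFinset = univ.image fun i : Fin l.length => l[i] + (i.rev : ℕ) := by
  ext x
  simp [betaList, List.mem_ofFn]

theorem card_toFinset_betaList {l : List ℕ} (hl : l.SortedGE) :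
    #(betaList l).toFinset = l.length := by
  rw [toFinset_betaList, card_image_of_injective _ (strictAnti_beta hl).injective, card_univ,
    Fintype.card_fin]

theorem sum_toFinset_betaList {l : List ℕ} (hl : l.SortedGE) :
    ∑ x ∈ (betaList l).toFinset, x = l.sum + ∑ x ∈ range l.length, x := by
  rw [toFinset_betaList, sum_image fun i _ j _ h => (strictAnti_beta hl).injective h,
    sum_add_distrib, ← Fin.sum_univ_getElem, Finset.sum_range]
  congr 1
  exact Equiv.sum_comp Fin.revPerm fun i : Fin l.length => (i : ℕ)

theorem zero_notMem_betaList {l : List ℕ} (hpos : ∀ x ∈ l, 0 < x) :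
    0 ∉ (betaList l).toFinset := by
  rw [toFinset_betaList, mem_image]
  rintro ⟨i, -, h⟩
  have := hpos l[i] (List.getElem_mem _)
  omega

/-- Beta numbers are strictly decreasing, so the set determines the list, and subtracting the
staircase recovers the parts. -/
theorem eq_of_toFinset_betaList_eq {l l' : List ℕ} (hl : l.SortedGE) (hl' : l'.SortedGE)
    (h : (betaList l).toFinset = (betaList l').toFinset) : l = l' := by
  have hlen : l.length = l'.length := by
    rw [← card_toFinset_betaList hl, h, card_toFinset_betaList hl']
  have hnd : ∀ {l : List ℕ}, l.SortedGE → (betaList l).Nodup := fun hl =>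
    (pairwise_betaList hl).imp fun h => h.ne'
  have hb : betaList l = betaList l' :=
    (List.perm_of_nodup_nodup_toFinset_eq (hnd hl) (hnd hl') h).eq_of_pairwise
      (fun a b _ _ hab hba => absurd (hab.trans hba) (lt_irrefl _)) (pairwise_betaList hl)
      (pairwise_betaList hl')
  refine List.ext_getElem hlen fun i h1 h2 => ?_
  have h3 : (betaList l)[i]? = (betaList l')[i]? := by rw [hb]
  rw [betaList, betaList, List.getElem?_ofFn, List.getElem?_ofFn, dif_pos h1, dif_pos h2] at h3
  have h4 := Option.some.inj h3
  simp only [Fin.val_rev, Fin.getElem_fin, hlen] at h4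
  exact Nat.add_right_cancel h4

end partition

section regular

variable {n p : ℕ}

theorem not_dvd_of_mem_partition (hp : p.Prime) {g : Perm (Fin n)} (hg : ¬ p ∣ orderOf g) {c : ℕ}
    (hc : c ∈ g.partition.parts) : ¬ p ∣ c := by
  rw [Equiv.Perm.parts_partition, Multiset.mem_add] at hc
  rcases hc with hc | hc
  · exact fun h => hg (h.trans (Equiv.Perm.dvd_of_mem_cycleType hc))
  · rw [Multiset.eq_of_mem_replicate hc]
    exact hp.not_dvd_one

theorem exists_regular_one {k : ℕ} (hk : 2 ≤ k) (hkn : k ≤ n) (hpk : ¬ p ∣ k) :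
    ∃ (g : Perm (Fin n)) (s : Multiset ℕ), ¬ p ∣ orderOf g ∧ g.partition.parts = k ::ₘ s := by
  obtain ⟨g, hg⟩ := (Equiv.Perm.exists_with_cycleType_iff (Fin n) (m := {k})).2
    (by simp [hk, hkn])
  refine ⟨g, _, ?_, by rw [Equiv.Perm.parts_partition, hg, Multiset.singleton_add]⟩
  rw [← Equiv.Perm.lcm_cycleType, hg, Multiset.lcm_singleton]
  simpa using hpk

theorem exists_regular_two (hp : p.Prime) {k l : ℕ} (hk : 2 ≤ k) (hl : 2 ≤ l) (hkl : k + l ≤ n)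
    (hpk : ¬ p ∣ k) (hpl : ¬ p ∣ l) : ∃ (g : Perm (Fin n)) (s : Multiset ℕ),
      ¬ p ∣ orderOf g ∧ g.partition.parts = k ::ₘ l ::ₘ s := by
  obtain ⟨g, hg⟩ := (Equiv.Perm.exists_with_cycleType_iff (Fin n) (m := {k, l})).2
    (by simp [hk, hl, hkl])
  refine ⟨g, _, ?_, by rw [Equiv.Perm.parts_partition, hg, Multiset.insert_eq_cons,
    Multiset.cons_add, Multiset.singleton_add]⟩
  rw [← Equiv.Perm.lcm_cycleType, hg, Multiset.insert_eq_cons, Multiset.lcm_cons,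
    Multiset.lcm_singleton]
  intro h
  rcases (hp.dvd_mul).1 (h.trans (Nat.lcm_dvd_mul k _)) with h | h
  · exact hpk h
  · exact hpl (by simpa using h)

end regular

end Specht

section main

open Finset Specht

variable {n p : ℕ} (lam : n.Partition)

theorem Nat.Partition.sum_sort_parts : (lam.parts.sort (· ≥ ·)).sum = n := by
  rw [← Multiset.sum_coe, Multiset.sort_eq, lam.parts_sum]

theorem Nat.Partition.pos_of_mem_sort_parts : ∀ x ∈ lam.parts.sort (· ≥ ·), 0 < x := fun _ hx =>
  lam.parts_pos ((Multiset.mem_sort _).1 hx)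

theorem Nat.Partition.sort_parts_eq {l : List ℕ} (hl : l.Pairwise (· ≥ ·))
    (h : lam.parts = (l : Multiset ℕ)) : lam.parts.sort (· ≥ ·) = l := by
  refine List.Perm.eq_of_pairwise (le := (· ≥ ·)) (fun a b _ _ hab hba => le_antisymm hba hab)
    (Multiset.pairwise_sort _ _) hl ?_
  rw [← Multiset.coe_eq_coe, Multiset.sort_eq, h]

theorem spechtRep_isIrreducible : (spechtRep lam).IsIrreducible := by
  obtain ⟨t⟩ := nonempty_tableau (Multiset.pairwise_sort lam.parts (· ≥ ·)).sortedGE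
    lam.pos_of_mem_sort_parts lam.sum_sort_parts
  exact rep_isIrreducible t

theorem spechtRep_character (g : Perm (Fin n)) :
    (spechtRep lam).character g = (cycleTypeCoeff g.partition.parts
      fun i : Fin (lam.parts.sort (· ≥ ·)).length =>
        (lam.parts.sort (· ≥ ·))[i] + (i.rev : ℕ) : ℤ) :=
  character_ofRowLens _ lam.pos_of_mem_sort_parts lam.sum_sort_parts g

/-- Character values depend only on cycle type, and a `p`-regular element has no cycle length
divisible by p. Positive parts with sum n number at most n, so fuel n suffices. -/
theorem isQuasiSteinberg_of_forall_regularTypes (hp : p.Prime) (hpn : p ∣ n.factorial) {l : List ℕ}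
    (hl : l.Pairwise (· ≥ ·)) (h : lam.parts = (l : Multiset ℕ))
    (hcheck : ∀ s ∈ regularTypes p n n n, evalCoeff s (betaList l) ≠ 0) :
    IsQuasiSteinberg p (spechtRep lam) where
  dvd_card := by rwa [Nat.card_eq_fintype_card, Fintype.card_perm, Fintype.card_fin]
  irreducible := spechtRep_isIrreducible lam
  character_ne_zero g hg := by
    rw [spechtRep_character, Int.cast_ne_zero]
    have hs : ((g.partition.parts.sort (· ≥ ·) : List ℕ) : Multiset ℕ) = g.partition.parts :=
      Multiset.sort_eq _ _
    rw [← hs, ← evalCoeff_ofFn]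
    have hsum : (g.partition.parts.sort (· ≥ ·)).sum = n := by
      rw [← Multiset.sum_coe, hs, g.partition.parts_sum, Fintype.card_fin]
    have hmem : ∀ c ∈ g.partition.parts.sort (· ≥ ·), c ∈ g.partition.parts := fun c hc =>
      (Multiset.mem_sort _).1 hc
    have hpos : ∀ c ∈ g.partition.parts.sort (· ≥ ·), 0 < c := fun c hc =>
      g.partition.parts_pos (hmem c hc)
    have hb : List.ofFn (fun i : Fin (lam.parts.sort (· ≥ ·)).length =>
        (lam.parts.sort (· ≥ ·))[i] + (i.rev : ℕ)) = betaList l := by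
      rw [← lam.sort_parts_eq hl h]
      rfl
    rw [hb]
    refine hcheck _ (mem_regularTypes ?_ hsum (Multiset.pairwise_sort _ _) ?_ hpos
      fun c hc => not_dvd_of_mem_partition hp hg (hmem c hc))
    · have := List.length_le_sum_of_one_le _ hpos
      omega
    · intro c hc
      rw [← hsum]
      exact List.le_sum_of_mem hc

variable {lam}

/-- A k-cycle with p not dividing k is `p`-regular, and its character value would vanish without a
hook of length k. -/
theorem IsQuasiSteinberg.exists_hook (h : IsQuasiSteinberg p (spechtRep lam)) {k : ℕ}
    (hk : 2 ≤ k) (hkn : k ≤ n) (hpk : ¬ p ∣ k) :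
    ∃ x ∈ (betaList (lam.parts.sort (· ≥ ·))).toFinset, k ≤ x ∧
      x - k ∉ (betaList (lam.parts.sort (· ≥ ·))).toFinset := by
  by_contra! hno
  obtain ⟨g, s, hg, hgs⟩ := exists_regular_one hk hkn hpk
  refine h.character_ne_zero g hg ?_
  rw [spechtRep_character, hgs, cycleTypeCoeff_cons_eq_zero (by omega), Int.cast_zero]
  rwa [toFinset_betaList] at hno

theorem IsQuasiSteinberg.exists_two_hooks (hp : p.Prime) (h : IsQuasiSteinberg p (spechtRep lam))
    {k l : ℕ} (hk : 2 ≤ k) (hl : 2 ≤ l) (hkl : k + l ≤ n) (hpk : ¬ p ∣ k) (hpl : ¬ p ∣ l) :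
    ∃ x, x ∈ (betaList (lam.parts.sort (· ≥ ·))).toFinset ∧ k ≤ x ∧
      x - k ∉ (betaList (lam.parts.sort (· ≥ ·))).toFinset ∧
      ∃ y, (y = x - k ∨ (y ≠ x ∧ y ∈ (betaList (lam.parts.sort (· ≥ ·))).toFinset)) ∧ l ≤ y ∧
        ¬ (y - l = x - k ∨
          (y - l ≠ x ∧ y - l ∈ (betaList (lam.parts.sort (· ≥ ·))).toFinset)) := by
  by_contra! hno
  obtain ⟨g, s, hg, hgs⟩ := exists_regular_two hp hk hl hkl hpk hpl
  refine h.character_ne_zero g hg ?_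
  rw [spechtRep_character, hgs, cycleTypeCoeff_cons_cons_eq_zero
    (strictAnti_beta (Multiset.pairwise_sort _ _).sortedGE).injective (by omega) (by omega),
    Int.cast_zero]
  rw [← toFinset_betaList]
  intro x hx hkx
  by_cases hxk : x - k ∈ (betaList (lam.parts.sort (· ≥ ·))).toFinset
  · exact Or.inl hxk
  · right
    intro y hy hly
    simp only [mem_insert, mem_erase] at hy ⊢
    exact hno x hx hkx hxk y hy hly

theorem parts_eq_of_mem_iff {l : List ℕ} (hl : l.Pairwise (· ≥ ·))
    (h : ∀ x, x ∈ (betaList (lam.parts.sort (· ≥ ·))).toFinset ↔ x ∈ (betaList l).toFinset) :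
    lam.parts = (l : Multiset ℕ) := by
  rw [← eq_of_toFinset_betaList_eq (Multiset.pairwise_sort lam.parts (· ≥ ·)).sortedGE hl.sortedGE
    (Finset.ext h), Multiset.sort_eq]

end main
end

/-! ### The classification. -/

section main

open Finset Specht

variable {n p : ℕ} {lam : n.Partition}

theorem Nat.Partition.two_le_length_sort_parts (hn : 3 ≤ n) (h_triv : lam.parts ≠ {n}) :
    2 ≤ (lam.parts.sort (· ≥ ·)).length := by
  have hsum := lam.sum_sort_parts
  have hparts : lam.parts = (lam.parts.sort (· ≥ ·) : Multiset ℕ) := (Multiset.sort_eq _ _).symm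
  match h : lam.parts.sort (· ≥ ·) with
  | [] =>
    rw [h, List.sum_nil] at hsum
    omega
  | [a] =>
    rw [h, List.sum_singleton] at hsum
    rw [h, hsum] at hparts
    exact absurd hparts h_triv
  | _ :: _ :: _ => simp

theorem Nat.Partition.length_sort_parts_lt (h_sign : lam.parts ≠ Multiset.replicate n 1) :
    (lam.parts.sort (· ≥ ·)).length < n := by
  have hpos := lam.pos_of_mem_sort_parts
  have hle := List.length_le_sum_of_one_le _ hpos
  rw [lam.sum_sort_parts] at hle
  refine hle.lt_of_ne fun heq => h_sign ?_
  rw [Multiset.length_sort] at heq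
  rw [Multiset.eq_replicate]
  refine ⟨heq, fun b hb => ?_⟩
  obtain ⟨s, hs⟩ := Multiset.exists_cons_of_mem hb
  have h1 : s.card ≤ s.sum := by
    have := Multiset.card_nsmul_le_sum (s := s) (a := 1) fun x hx =>
      lam.parts_pos (hs ▸ Multiset.mem_cons_of_mem hx)
    simpa using this
  have h2 := lam.parts_sum
  rw [hs, Multiset.sum_cons] at h2
  rw [hs, Multiset.card_cons] at heq
  have h3 := lam.parts_pos hb
  omega

/-- If `χ_lam` is quasi `p`-Steinberg, then `lam` is a hook (and `p ∤ n`) or a hook with one further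
cell at the corner `(1, 1)` (and `p ∣ n`). -/
theorem IsQuasiSteinberg.mem_iff (hn : 3 ≤ n) (hp : p.Prime) (h_triv : lam.parts ≠ {n})
    (h_sign : lam.parts ≠ Multiset.replicate n 1) (h : IsQuasiSteinberg p (spechtRep lam)) :
    (¬ p ∣ n ∧ ∀ y, y ∈ (betaList (lam.parts.sort (· ≥ ·))).toFinset ↔
        y = n ∨ (1 ≤ y ∧ y < (lam.parts.sort (· ≥ ·)).length)) ∨
      (p ∣ n ∧ (lam.parts.sort (· ≥ ·)).length + 2 ≤ n ∧
        ∀ y, y ∈ (betaList (lam.parts.sort (· ≥ ·))).toFinset ↔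
          y = n - 1 ∨ y = (lam.parts.sort (· ≥ ·)).length ∨
            (1 ≤ y ∧ y + 1 < (lam.parts.sort (· ≥ ·)).length)) := by
  have hm := lam.two_le_length_sort_parts hn h_triv
  have hmn := lam.length_sort_parts_lt h_sign
  have hs := (Multiset.pairwise_sort lam.parts (· ≥ ·)).sortedGE
  have h0 := zero_notMem_betaList lam.pos_of_mem_sort_parts
  have hcard := card_toFinset_betaList hs
  have hsum := sum_toFinset_betaList hs
  rw [lam.sum_sort_parts] at hsum
  generalize (lam.parts.sort (· ≥ ·)).length = m at *
  rw [← hcard] at hsum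
  by_cases hpn : p ∣ n
  · right
    have hpn1 : ¬ p ∣ n - 1 := fun h1 => hp.not_dvd_one <| by
      have := Nat.dvd_sub hpn h1
      rwa [Nat.sub_sub_self (by omega)] at this
    have hX := mem_iff_of_almost_hook h0 (by omega) (by omega) hsum
      (h.exists_hook (by omega) (by omega) hpn1)
    rw [hcard] at hX
    refine ⟨hpn, ?_, hX⟩
    -- If m = n - 1, the two special elements n - 1 and m coincide and the beta set has fewer than m
    -- elements.
    by_contra hlt
    have hsub : (betaList (lam.parts.sort (· ≥ ·))).toFinset ⊆ insert m (Ico 1 (m - 1)) := by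
      intro y hy
      rw [hX] at hy
      rw [mem_insert, mem_Ico]
      omega
    have := (card_le_card hsub).trans (card_insert_le _ _)
    rw [Nat.card_Ico] at this
    omega
  · left
    have hX := mem_iff_of_hook h0 (card_pos.1 (by omega)) hsum
      (h.exists_hook (by omega) le_rfl hpn)
    rw [hcard] at hX
    exact ⟨hpn, hX⟩

theorem IsQuasiSteinberg.mem_list (hn : 3 ≤ n) (hp : p.Prime) (h_triv : lam.parts ≠ {n})
    (h_sign : lam.parts ≠ Multiset.replicate n 1) (h : IsQuasiSteinberg p (spechtRep lam)) :
    (n, lam.parts, p) ∈ ({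
        (3, {2, 1}, 2),
        (4, {2, 2}, 2),
        (4, {3, 1}, 3), (4, {2, 1, 1}, 3),
        (5, {4, 1}, 2), (5, {2, 1, 1, 1}, 2),
        (5, {3, 2}, 5), (5, {2, 2, 1}, 5),
        (6, {3, 2, 1}, 2),
        (6, {4, 2}, 3), (6, {2, 2, 1, 1}, 3),
        (8, {5, 2, 1}, 2), (8, {3, 2, 1, 1, 1}, 2)} : Set (ℕ × Multiset ℕ × ℕ)) := by
  have hm := lam.two_le_length_sort_parts hn h_triv
  have hmn := lam.length_sort_parts_lt h_sign
  have key : ∀ l : List ℕ, l.Pairwise (· ≥ ·) →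
      (∀ x, x ∈ (betaList (lam.parts.sort (· ≥ ·))).toFinset ↔ x ∈ (betaList l).toFinset) →
        lam.parts = (l : Multiset ℕ) := fun l hl h => parts_eq_of_mem_iff hl h
  have h1 := fun k hk hkn hpk => h.exists_hook (k := k) hk hkn hpk
  have h2 := fun k l hk hl hkl hpk hpl =>
    h.exists_two_hooks hp (k := k) (l := l) hk hl hkl hpk hpl
  have hX := h.mem_iff hn hp h_triv h_sign
  clear h
  -- The number of parts becomes a variable, so that the numerical cases can be substituted; the
  -- partition is then recovered from its beta set.
  generalize (lam.parts.sort (· ≥ ·)).length = m at *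
  simp only [Set.mem_insert_iff, Set.mem_singleton_iff, Prod.mk.injEq]
  rcases hX with ⟨-, hX⟩ | ⟨hpn, hmn', hX⟩
  · rcases classify_hook hp hn hm hmn hX h1 h2 with
      ⟨rfl, rfl, rfl⟩ | ⟨rfl, rfl, rfl⟩ | ⟨rfl, rfl, rfl⟩ | ⟨rfl, rfl, rfl⟩ | ⟨rfl, rfl, rfl⟩
    · have := key [2, 1] (by decide) fun x => by
        rw [hX]
        simp [betaList]
        omega
      rw [this]
      decide
    · have := key [3, 1] (by decide) fun x => by
        rw [hX]
        simp [betaList]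
        omega
      rw [this]
      decide
    · have := key [2, 1, 1] (by decide) fun x => by
        rw [hX]
        simp [betaList]
        omega
      rw [this]
      decide
    · have := key [4, 1] (by decide) fun x => by
        rw [hX]
        simp [betaList]
        omega
      rw [this]
      decide
    · have := key [2, 1, 1, 1] (by decide) fun x => by
        rw [hX]
        simp [betaList]
        omega
      rw [this]
      decide
  · rcases classify_almost_hook hp hm hmn' hpn hX h1 h2 with
      ⟨rfl, rfl, rfl⟩ | ⟨rfl, rfl, rfl⟩ | ⟨rfl, rfl, rfl⟩ | ⟨rfl, rfl, rfl⟩ |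
      ⟨rfl, rfl, rfl⟩ | ⟨rfl, rfl, rfl⟩ | ⟨rfl, rfl, rfl⟩ | ⟨rfl, rfl, rfl⟩
    · have := key [2, 2] (by decide) fun x => by
        rw [hX]
        simp [betaList]
        omega
      rw [this]
      decide
    · have := key [3, 2] (by decide) fun x => by
        rw [hX]
        simp [betaList]
        omega
      rw [this]
      decide
    · have := key [2, 2, 1] (by decide) fun x => by
        rw [hX]
        simp [betaList]
        omega
      rw [this]
      decide
    · have := key [3, 2, 1] (by decide) fun x => by
        rw [hX]
        simp [betaList]
        omega
      rw [this]
      decide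
    · have := key [4, 2] (by decide) fun x => by
        rw [hX]
        simp [betaList]
        omega
      rw [this]
      decide
    · have := key [2, 2, 1, 1] (by decide) fun x => by
        rw [hX]
        simp [betaList]
        omega
      rw [this]
      decide
    · have := key [5, 2, 1] (by decide) fun x => by
        rw [hX]
        simp [betaList]
        omega
      rw [this]
      decide
    · have := key [3, 2, 1, 1, 1] (by decide) fun x => by
        rw [hX]
        simp [betaList]
        omega
      rw [this]
      decide

end main

theorem theorem1p1 (n : ℕ) (hn : 3 ≤ n) (lam : n.Partition)
    (h_triv : lam.parts ≠ {n}) (h_sign : lam.parts ≠ Multiset.replicate n 1)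
    (p : ℕ) (hp : p.Prime) :
    (IsQuasiSteinberg p (spechtRep lam) ↔
      (n, lam.parts, p) ∈ ({
        (3, {2, 1}, 2),
        (4, {2, 2}, 2),
        (4, {3, 1}, 3), (4, {2, 1, 1}, 3),
        (5, {4, 1}, 2), (5, {2, 1, 1, 1}, 2),
        (5, {3, 2}, 5), (5, {2, 2, 1}, 5),
        (6, {3, 2, 1}, 2),
        (6, {4, 2}, 3), (6, {2, 2, 1, 1}, 3),
        (8, {5, 2, 1}, 2), (8, {3, 2, 1, 1, 1}, 2)} : Set (ℕ × Multiset ℕ × ℕ))) ∧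
    (IsQuasiSteinberg p (spechtRep lam) → n ≤ 8) := by
  -- The converse evaluates each listed character on all `p`-regular cycle types by kernel
  -- computation; the bound on n is read off the list.
  refine ⟨⟨fun h => h.mem_list hn hp h_triv h_sign, ?_⟩, fun h => ?_⟩
  · simp only [Set.mem_insert_iff, Set.mem_singleton_iff, Prod.mk.injEq]
    rintro (⟨rfl, h, rfl⟩ | ⟨rfl, h, rfl⟩ | ⟨rfl, h, rfl⟩ | ⟨rfl, h, rfl⟩ | ⟨rfl, h, rfl⟩ |
      ⟨rfl, h, rfl⟩ | ⟨rfl, h, rfl⟩ | ⟨rfl, h, rfl⟩ | ⟨rfl, h, rfl⟩ | ⟨rfl, h, rfl⟩ |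
      ⟨rfl, h, rfl⟩ | ⟨rfl, h, rfl⟩ | ⟨rfl, h, rfl⟩)
    · exact isQuasiSteinberg_of_forall_regularTypes lam hp (by decide) (l := [2, 1]) (by decide) h
        (by decide +kernel)
    · exact isQuasiSteinberg_of_forall_regularTypes lam hp (by decide) (l := [2, 2]) (by decide) h
        (by decide +kernel)
    · exact isQuasiSteinberg_of_forall_regularTypes lam hp (by decide) (l := [3, 1]) (by decide) h
        (by decide +kernel)
    · exact isQuasiSteinberg_of_forall_regularTypes lam hp (by decide) (l := [2, 1, 1]) (by decide) h
        (by decide +kernel)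
    · exact isQuasiSteinberg_of_forall_regularTypes lam hp (by decide) (l := [4, 1]) (by decide) h
        (by decide +kernel)
    · exact isQuasiSteinberg_of_forall_regularTypes lam hp (by decide) (l := [2, 1, 1, 1]) (by decide) h
        (by decide +kernel)
    · exact isQuasiSteinberg_of_forall_regularTypes lam hp (by decide) (l := [3, 2]) (by decide) h
        (by decide +kernel)
    · exact isQuasiSteinberg_of_forall_regularTypes lam hp (by decide) (l := [2, 2, 1]) (by decide) h
        (by decide +kernel)
    · exact isQuasiSteinberg_of_forall_regularTypes lam hp (by decide) (l := [3, 2, 1]) (by decide) h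
        (by decide +kernel)
    · exact isQuasiSteinberg_of_forall_regularTypes lam hp (by decide) (l := [4, 2]) (by decide) h
        (by decide +kernel)
    · exact isQuasiSteinberg_of_forall_regularTypes lam hp (by decide) (l := [2, 2, 1, 1]) (by decide) h
        (by decide +kernel)
    · exact isQuasiSteinberg_of_forall_regularTypes lam hp (by decide) (l := [5, 2, 1]) (by decide) h
        (by decide +kernel)
    · exact isQuasiSteinberg_of_forall_regularTypes lam hp (by decide) (l := [3, 2, 1, 1, 1]) (by decide) h
        (by decide +kernel)
  · have := h.mem_list hn hp h_triv h_sign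
    simp only [Set.mem_insert_iff, Set.mem_singleton_iff, Prod.mk.injEq] at this
    omega
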